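/- Let $\mathcal C$ be an additive bicategory: each $\mathcal C(a,b)$ is an additive category and horizontal composition $\times$ of 2-cells is biadditive. Vertical composition is $\circ$; coherence isomorphisms $\alpha,\lambda,\rho$ are suppressed, and a 1-cell also denotes its identity 2-cell. Let $\iota$ be a Frobenius 1-morphism with two-sided dual $\bar\iota$, i.e. let $\mathrm{ev}_L:\bar\iota\times\iota\to 1$, $\mathrm{coev}_L:1\to\iota\times\bar\iota$, $\mathrm{ev}_R:\iota\times\bar\iota\to 1$, $\mathrm{coev}_R:1\to\bar\iota\times\iota$ be 2-cells with $$(\iota\times \mathrm{ev}_L)\circ(\mathrm{coev}_L\times\iota)=\iota,\quad (\mathrm{ev}_L\times\bar\iota)\circ(\bar\iota\times\mathrm{coev}_L)=\bar\iota,\quad (\mathrm{ev}_R\times\iota)\circ(\iota\times\mathrm{coev}_R)=\iota,\quad (\bar\iota\times\mathrm{ev}_R)\circ(\mathrm{coev}_R\times\bar\iota)=\bar\iota .$$ Assume the (left) depth 2 condition: $(\iota\times\bar\iota)\times\iota$ is a direct summand (a retract) of a finite direct sum of copies of $\iota$. Let $A=\mathrm{End}(\iota\times\bar\iota)$, $B=\mathrm{End}(\bar\iota\times\iota)$,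 $L=\mathrm{End}(\iota)$, $R=\mathrm{End}(\bar\iota)$, rings under $\circ$, and put - $a_1*a_2=(\iota\times\mathrm{ev}_L\times\bar\iota)\circ(a_1\times a_2)\circ(\iota\times\mathrm{coev}_R\times\bar\iota)$ on $A$ and $b_1*b_2=(\bar\iota\times\mathrm{ev}_R\times\iota)\circ(b_1\times b_2)\circ(\bar\iota\times\mathrm{coev}_L\times\iota)$ on $B$; - $\mathcal F,\dot{\mathcal F}:A\to B$, $\mathcal F(a)=(\bar\iota\times\iota\times\mathrm{ev}_L)\circ(\bar\iota\times a\times\iota)\circ(\mathrm{coev}_R\times\bar\iota\times\iota)$, $\dot{\mathcal F}(a)=(\mathrm{ev}_L\times\bar\iota\times\iota)\circ(\bar\iota\times a\times\iota)\circ(\bar\iota\times\iota\times\mathrm{coev}_R)$; - $\mu,\nu:L\to R^{op}$, $\mu(l)=(\mathrm{ev}_L\times\bar\iota)\circ(\bar\iota\times l\times\bar\iota)\circ(\bar\iota\times\mathrm{coev}_L)$, $\nu(l)=(\bar\iota\times\mathrm{ev}_R)\circ(\bar\iota\times l\times\bar\iota)\circ(\mathrm{coev}_R\times\bar\iota)$;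 - $\phi_L:A\to L$, $\phi_L(a)=(\iota\times\mathrm{ev}_L)\circ(a\times\iota)\circ(\iota\times\mathrm{coev}_R)$, and $i_A=\mathrm{coev}_L\circ\mathrm{ev}_R\in A$. A D2 quasi-basis is a finite family of pairs $y_i,x_i\in A$ with $\sum_i (y_i\times\iota)\circ(\iota\times\mathrm{coev}_R)\circ(\iota\times\mathrm{ev}_L)\circ(x_i\times\iota)=(\iota\times\bar\iota)\times\iota$. Recall that a left bialgebroid $(A,L,s_L,t_L,\gamma_L,\pi_L)$ consists of rings $A,L$, ring homomorphisms $s_L:L\to A$, $t_L:L^{op}\to A$ with commuting images, and a comonoid $(A,\gamma_L,\pi_L)$ in $L$-$L$-bimodules, where $l\cdot a\cdot l'=s_L(l)t_L(l')a$ and $\gamma_L(a)=a_{(1)}\otimes a_{(2)}\in A_L\otimes{}_LA$, such that $a_{(1)}t_L(l)\otimes a_{(2)}=a_{(1)}\otimes a_{(2)}s_L(l)$, $\gamma_L$ is multiplicative and unital, $\pi_L(1)=1$, $\pi_L(a\,s_L\pi_L(b))=\pi_L(ab)=\pi_L(a\,t_L\pi_L(b))$. A right bialgebroid $(A,R,s_R,t_R,\gamma_R,\pi_R)$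 is the mirror notion, with $r\cdot a\cdot r'=a\,s_R(r')t_R(r)$ and $\gamma_R(a)=a^{(1)}\otimes a^{(2)}\in A^R\otimes{}^RA$. A Hopf algebroid is a left and a right bialgebroid on the same ring $A$ with $R\cong L^{op}$ and an additive bijection $S:A\to A$ such that $s_L(L)=t_R(R)$, $t_L(L)=s_R(R)$; $(\gamma_L\otimes\mathrm{id})\gamma_R=(\mathrm{id}\otimes\gamma_R)\gamma_L$, $(\gamma_R\otimes\mathrm{id})\gamma_L=(\mathrm{id}\otimes\gamma_L)\gamma_R$; $S(t_L(l)a\,t_L(l'))=s_L(l')S(a)s_L(l)$, $S(t_R(r')a\,t_R(r))=s_R(r)S(a)s_R(r')$; $S(a_{(1)})a_{(2)}=s_R\pi_R(a)$, $a^{(1)}S(a^{(2)})=s_L\pi_L(a)$. Then $\mathcal F,\dot{\mathcal F}$ are additive bijections, $\mu,\nu$ are ring isomorphisms, $\iota$ is depth 2 also on the right ($(\bar\iota\times\iota)\times\bar\iota$ is a direct summand of a finite direct sum of copies of $\bar\iota$), D2 quasi-bases exist, and for every D2 quasi-basis $(y_i,x_i)$: (1) with $S_A=\dot{\mathcal F}^{-1}\circ\mathcal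 F$, the maps $$\begin{array}{ll} s_L(l)=l\times\bar\iota, & t_L(l)=\iota\times\mu(l),\\ \gamma_L(a)=\sum_i a*S_A^{-1}(y_i)\otimes x_i=\sum_i S_A^{-1}(y_i)\otimes x_i*a, & \pi_L(a)=\phi_L(a\circ i_A),\\ s_R(r)=\iota\times r, & t_R(r)=\nu^{-1}(r)\times\bar\iota,\\ \gamma_R(a)=\sum_i a*S_A(x_i)\otimes y_i=\sum_i S_A(x_i)\otimes y_i*a, & \pi_R(a)=\nu(\phi_L(S_A^{-1}(a)\circ i_A))\end{array}$$ are a left bialgebroid structure over $L$ and a right bialgebroid structure over $R$ on $A$ which, together with the antipode $S_A$, form a Hopf algebroid; (2) with $S_B=\mathcal F\circ\dot{\mathcal F}^{-1}$, the maps $$\begin{array}{ll} s_L(r)=r\times\iota, & t_L(r)=\bar\iota\times\nu^{-1}(r),\\ \gamma_L(b)=\sum_i b*\mathcal F(x_i)\otimes \mathcal F(y_i)=\sum_i \mathcal F(x_i)\otimes \mathcal F(y_i)*b, & \pi_L(b)=\nu(\phi_L(\mathcal F^{-1}(b))),\\ s_R(l)=\bar\iota\times l, & t_R(l)=\mu(l)\times\iota,\\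 \gamma_R(b)=\sum_i b*\dot{\mathcal F}(y_i)\otimes \dot{\mathcal F}(x_i)=\sum_i \dot{\mathcal F}(y_i)\otimes\dot{\mathcal F}(x_i)*b, & \pi_R(b)=\phi_L(\dot{\mathcal F}^{-1}(b))\end{array}$$ are a left bialgebroid structure over $R$ and a right bialgebroid structure over $L$ on $B$ which, together with the antipode $S_B$, form a Hopf algebroid. -/

import Mathlib

open CategoryTheory CategoryTheory.Limits MulOpposite
open scoped TensorProduct Bicategory

universe w v u

/-! ### Balanced tensor products over noncommutative rings

`ρ : R → M → M` is the right action and `lam : R → N → N` the left action of `R` that are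
balanced against each other. They are passed explicitly because one ring `A` carries several
module structures at the same time. -/

section Balanced

variable {R R' M N P : Type*} [AddCommGroup M] [AddCommGroup N] [AddCommGroup P]

/-- The relations `(m · r) ⊗ n = m ⊗ (r · n)`. -/
def balRel (ρ : R → M → M) (lam : R → N → N) : AddSubgroup (M ⊗[ℤ] N) :=
  AddSubgroup.closure {z | ∃ (r : R) (m : M) (n : N), z = ρ r m ⊗ₜ[ℤ] n - m ⊗ₜ[ℤ] lam r n}

/-- The tensor product `M ⊗_R N`, an additive group. -/
abbrev Bal (ρ : R → M → M) (lam : R → N → N) : Type _ := (M ⊗[ℤ] N) ⧸ balRel ρ lam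

/-- The element `m ⊗ n` of `M ⊗_R N`. -/
def Bal.tmul {ρ : R → M → M} {lam : R → N → N} (m : M) (n : N) : Bal ρ lam :=
  QuotientAddGroup.mk' (balRel ρ lam) (m ⊗ₜ[ℤ] n)

/-- Every element of `M ⊗_R N` is a finite sum of elements `m ⊗ n`. -/
theorem Bal.exists_rep {ρ : R → M → M} {lam : R → N → N} (z : Bal ρ lam) :
    ∃ (n : ℕ) (p : Fin n → M) (q : Fin n → N), z = ∑ i, Bal.tmul (p i) (q i) := by
  obtain ⟨w, rfl⟩ := QuotientAddGroup.mk'_surjective (balRel ρ lam) z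
  induction w with
  | zero => exact ⟨0, Fin.elim0, Fin.elim0, by simp⟩
  | tmul m n => exact ⟨1, fun _ => m, fun _ => n, by simp [Bal.tmul]⟩
  | add x y hx hy =>
    obtain ⟨n, p, q, h⟩ := hx
    obtain ⟨n', p', q', h'⟩ := hy
    refine ⟨n + n', Fin.append p p', Fin.append q q', ?_⟩
    rw [map_add, h, h', Fin.sum_univ_add]
    simp

/-- The relations of a triple tensor product `M ⊗_R N ⊗_R' P`. -/
def balRel₃ (ρ₁ : R → M → M) (lam₂ : R → N → N) (ρ₂ : R' → N → N) (lam₃ : R' → P → P) :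
    AddSubgroup (M ⊗[ℤ] (N ⊗[ℤ] P)) :=
  AddSubgroup.closure
    ({z | ∃ (r : R) (m : M) (n : N) (p : P),
        z = ρ₁ r m ⊗ₜ[ℤ] (n ⊗ₜ[ℤ] p) - m ⊗ₜ[ℤ] (lam₂ r n ⊗ₜ[ℤ] p)} ∪
      {z | ∃ (r : R') (m : M) (n : N) (p : P),
        z = m ⊗ₜ[ℤ] (ρ₂ r n ⊗ₜ[ℤ] p) - m ⊗ₜ[ℤ] (n ⊗ₜ[ℤ] lam₃ r p)})

/-- The triple tensor product `M ⊗_R N ⊗_R' P`. -/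
abbrev Bal₃ (ρ₁ : R → M → M) (lam₂ : R → N → N) (ρ₂ : R' → N → N) (lam₃ : R' → P → P) :
    Type _ := (M ⊗[ℤ] (N ⊗[ℤ] P)) ⧸ balRel₃ ρ₁ lam₂ ρ₂ lam₃

/-- The map `z ↦ z ⊗ p` from `M ⊗_R N` to `M ⊗_R N ⊗_R' P`. -/
def Bal.tmulRight {ρ₁ : R → M → M} {lam₂ : R → N → N} {ρ₂ : R' → N → N} {lam₃ : R' → P → P}
    (z : Bal ρ₁ lam₂) (p : P) : Bal₃ ρ₁ lam₂ ρ₂ lam₃ :=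
  QuotientAddGroup.lift (balRel ρ₁ lam₂)
    ((QuotientAddGroup.mk' (balRel₃ ρ₁ lam₂ ρ₂ lam₃)).comp
      (((TensorProduct.mk ℤ N P).flip p).lTensor M).toAddMonoidHom)
    ((AddSubgroup.closure_le _).2 (by
      rintro _ ⟨r, m, n, rfl⟩
      refine (QuotientAddGroup.eq_zero_iff _).2 (AddSubgroup.subset_closure (Or.inl ⟨r, m, n, p, ?_⟩))
      exact map_sub (((TensorProduct.mk ℤ N P).flip p).lTensor M).toAddMonoidHom
        (ρ₁ r m ⊗ₜ[ℤ] n) (m ⊗ₜ[ℤ] lam₂ r n))) z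

/-- The map `z ↦ m ⊗ z` from `N ⊗_R' P` to `M ⊗_R N ⊗_R' P`. -/
def Bal.tmulLeft {ρ₁ : R → M → M} {lam₂ : R → N → N} {ρ₂ : R' → N → N} {lam₃ : R' → P → P}
    (m : M) (z : Bal ρ₂ lam₃) : Bal₃ ρ₁ lam₂ ρ₂ lam₃ :=
  QuotientAddGroup.lift (balRel ρ₂ lam₃)
    ((QuotientAddGroup.mk' (balRel₃ ρ₁ lam₂ ρ₂ lam₃)).comp
      (TensorProduct.mk ℤ M (N ⊗[ℤ] P) m).toAddMonoidHom)
    ((AddSubgroup.closure_le _).2 (by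
      rintro _ ⟨r, n, p, rfl⟩
      refine (QuotientAddGroup.eq_zero_iff _).2 (AddSubgroup.subset_closure (Or.inr ⟨r, m, n, p, ?_⟩))
      simp [TensorProduct.tmul_sub])) z

end Balanced

/-! ### Bialgebroids and Hopf algebroids

Sweedler notation is spelled out: `γ a = ∑ i, p i ⊗ q i` stands for `γ(a) = a₍₁₎ ⊗ a₍₂₎`, and an
axiom in Sweedler notation is required for every way of writing `γ a` as such a sum. (The other
axioms make the expressions independent of that choice.) -/

section Bialgebroid

variable {A L R : Type*} [Ring A] [Ring L] [Ring R]

/-- The right `L`-module `A_L`: `a · l = t(l) a`. -/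
def actAL (t : Lᵐᵒᵖ →+* A) (l : L) (a : A) : A := t (op l) * a

/-- The left `L`-module `_L A`: `l · a = s(l) a`. -/
def actLA (s : L →+* A) (l : L) (a : A) : A := s l * a

/-- The right `R`-module `A^R`: `a · r = a s(r)`. -/
def actAR (s : R →+* A) (r : R) (a : A) : A := a * s r

/-- The left `R`-module `^R A`: `r · a = a t(r)`. -/
def actRA (t : Rᵐᵒᵖ →+* A) (r : R) (a : A) : A := a * t (op r)

end Bialgebroid

/-- A left bialgebroid with total ring `A` and base ring `L`. -/
structure LeftBialgebroid (A L : Type*) [Ring A] [Ring L] where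
  /-- source map -/
  s : L →+* A
  /-- target map -/
  t : Lᵐᵒᵖ →+* A
  /-- coproduct `A → A_L ⊗ _L A` -/
  γ : A →+ Bal (actAL t) (actLA s)
  /-- counit -/
  π : A →+ L
  comm : ∀ l l' : L, s l * t (op l') = t (op l') * s l
  -- `γ` and `π` are maps of `L`-`L` bimodules, for `l · a · l' = s(l) t(l') a`
  γ_left : ∀ (l : L) (a : A) (n : ℕ) (p q : Fin n → A), γ a = ∑ i, Bal.tmul (p i) (q i) →
    γ (s l * a) = ∑ i, Bal.tmul (s l * p i) (q i)
  γ_right : ∀ (l : L) (a : A) (n : ℕ) (p q : Fin n → A), γ a = ∑ i, Bal.tmul (p i) (q i) →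
    γ (t (op l) * a) = ∑ i, Bal.tmul (p i) (t (op l) * q i)
  π_left : ∀ (l : L) (a : A), π (s l * a) = l * π a
  π_right : ∀ (l : L) (a : A), π (t (op l) * a) = π a * l
  -- comonoid axioms: `(γ ⊗ id) ∘ γ = (id ⊗ γ) ∘ γ` in `A_L ⊗ _L A_L ⊗ _L A`, and the counit laws
  coassoc : ∀ (a : A) (n : ℕ) (p q : Fin n → A), γ a = ∑ i, Bal.tmul (p i) (q i) →
    (∑ i, Bal.tmulRight (γ (p i)) (q i) : Bal₃ (actAL t) (actLA s) (actAL t) (actLA s)) =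
      ∑ i, Bal.tmulLeft (p i) (γ (q i))
  counit_left : ∀ (a : A) (n : ℕ) (p q : Fin n → A), γ a = ∑ i, Bal.tmul (p i) (q i) →
    ∑ i, s (π (p i)) * q i = a
  counit_right : ∀ (a : A) (n : ℕ) (p q : Fin n → A), γ a = ∑ i, Bal.tmul (p i) (q i) →
    ∑ i, t (op (π (q i))) * p i = a
  -- compatibility with the ring structure of `A`
  γ_cross : ∀ (l : L) (a : A) (n : ℕ) (p q : Fin n → A), γ a = ∑ i, Bal.tmul (p i) (q i) →
    (∑ i, Bal.tmul (p i * t (op l)) (q i) : Bal (actAL t) (actLA s)) =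
      ∑ i, Bal.tmul (p i) (q i * s l)
  γ_one : γ 1 = Bal.tmul 1 1
  γ_mul : ∀ (a b : A) (n : ℕ) (p q : Fin n → A) (m : ℕ) (p' q' : Fin m → A),
    γ a = ∑ i, Bal.tmul (p i) (q i) → γ b = ∑ j, Bal.tmul (p' j) (q' j) →
    γ (a * b) = ∑ i, ∑ j, Bal.tmul (p i * p' j) (q i * q' j)
  π_one : π 1 = 1
  π_mul_s : ∀ a b : A, π (a * s (π b)) = π (a * b)
  π_mul_t : ∀ a b : A, π (a * t (op (π b))) = π (a * b)

/-- A right bialgebroid with total ring `A` and base ring `R`. -/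
structure RightBialgebroid (A R : Type*) [Ring A] [Ring R] where
  /-- source map -/
  s : R →+* A
  /-- target map -/
  t : Rᵐᵒᵖ →+* A
  /-- coproduct `A → A^R ⊗ ^R A` -/
  γ : A →+ Bal (actAR s) (actRA t)
  /-- counit -/
  π : A →+ R
  comm : ∀ r r' : R, s r * t (op r') = t (op r') * s r
  -- `γ` and `π` are maps of `R`-`R` bimodules, for `r · a · r' = a s(r') t(r)`
  γ_left : ∀ (r : R) (a : A) (n : ℕ) (p q : Fin n → A), γ a = ∑ i, Bal.tmul (p i) (q i) →
    γ (a * t (op r)) = ∑ i, Bal.tmul (p i * t (op r)) (q i)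
  γ_right : ∀ (r : R) (a : A) (n : ℕ) (p q : Fin n → A), γ a = ∑ i, Bal.tmul (p i) (q i) →
    γ (a * s r) = ∑ i, Bal.tmul (p i) (q i * s r)
  π_left : ∀ (r : R) (a : A), π (a * t (op r)) = r * π a
  π_right : ∀ (r : R) (a : A), π (a * s r) = π a * r
  -- comonoid axioms: `(γ ⊗ id) ∘ γ = (id ⊗ γ) ∘ γ` in `A^R ⊗ ^R A^R ⊗ ^R A`, and the counit laws
  coassoc : ∀ (a : A) (n : ℕ) (p q : Fin n → A), γ a = ∑ i, Bal.tmul (p i) (q i) →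
    (∑ i, Bal.tmulRight (γ (p i)) (q i) : Bal₃ (actAR s) (actRA t) (actAR s) (actRA t)) =
      ∑ i, Bal.tmulLeft (p i) (γ (q i))
  counit_left : ∀ (a : A) (n : ℕ) (p q : Fin n → A), γ a = ∑ i, Bal.tmul (p i) (q i) →
    ∑ i, q i * t (op (π (p i))) = a
  counit_right : ∀ (a : A) (n : ℕ) (p q : Fin n → A), γ a = ∑ i, Bal.tmul (p i) (q i) →
    ∑ i, p i * s (π (q i)) = a
  -- compatibility with the ring structure of `A`
  γ_cross : ∀ (r : R) (a : A) (n : ℕ) (p q : Fin n → A), γ a = ∑ i, Bal.tmul (p i) (q i) →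
    (∑ i, Bal.tmul (s r * p i) (q i) : Bal (actAR s) (actRA t)) =
      ∑ i, Bal.tmul (p i) (t (op r) * q i)
  γ_one : γ 1 = Bal.tmul 1 1
  γ_mul : ∀ (a b : A) (n : ℕ) (p q : Fin n → A) (m : ℕ) (p' q' : Fin m → A),
    γ a = ∑ i, Bal.tmul (p i) (q i) → γ b = ∑ j, Bal.tmul (p' j) (q' j) →
    γ (a * b) = ∑ i, ∑ j, Bal.tmul (p i * p' j) (q i * q' j)
  π_one : π 1 = 1
  π_s_mul : ∀ a b : A, π (s (π a) * b) = π (a * b)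
  π_t_mul : ∀ a b : A, π (t (op (π a)) * b) = π (a * b)

/-- A Hopf algebroid in the sense of Böhm and Szlachányi: a left bialgebroid over `L` and a right
bialgebroid over `R` on the same ring `A`, with an antipode `S`. -/
structure HopfAlgebroid (A L R : Type*) [Ring A] [Ring L] [Ring R] where
  left : LeftBialgebroid A L
  right : RightBialgebroid A R
  /-- antipode -/
  S : A ≃+ A
  base : Nonempty (R ≃+* Lᵐᵒᵖ)
  range_s_left : left.s.range = right.t.range
  range_t_left : left.t.range = right.s.range
  -- `(γ_L ⊗ id) ∘ γ_R = (id ⊗ γ_R) ∘ γ_L` in `A_L ⊗ _L A^R ⊗ ^R A`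
  coassoc_left_right : ∀ (a : A) (n : ℕ) (p q : Fin n → A) (m : ℕ) (p' q' : Fin m → A),
    right.γ a = ∑ i, Bal.tmul (p i) (q i) → left.γ a = ∑ j, Bal.tmul (p' j) (q' j) →
    (∑ i, Bal.tmulRight (left.γ (p i)) (q i) :
        Bal₃ (actAL left.t) (actLA left.s) (actAR right.s) (actRA right.t)) =
      ∑ j, Bal.tmulLeft (p' j) (right.γ (q' j))
  -- `(γ_R ⊗ id) ∘ γ_L = (id ⊗ γ_L) ∘ γ_R` in `A^R ⊗ ^R A_L ⊗ _L A`
  coassoc_right_left : ∀ (a : A) (n : ℕ) (p q : Fin n → A) (m : ℕ) (p' q' : Fin m → A),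
    left.γ a = ∑ i, Bal.tmul (p i) (q i) → right.γ a = ∑ j, Bal.tmul (p' j) (q' j) →
    (∑ i, Bal.tmulRight (right.γ (p i)) (q i) :
        Bal₃ (actAR right.s) (actRA right.t) (actAL left.t) (actLA left.s)) =
      ∑ j, Bal.tmulLeft (p' j) (left.γ (q' j))
  S_left : ∀ (l l' : L) (a : A),
    S (left.t (op l) * a * left.t (op l')) = left.s l' * S a * left.s l
  S_right : ∀ (r r' : R) (a : A),
    S (right.t (op r') * a * right.t (op r)) = right.s r * S a * right.s r'
  -- `S(a₍₁₎) a₍₂₎ = s_R(π_R(a))` and `a⁽¹⁾ S(a⁽²⁾) = s_L(π_L(a))`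
  antipode_left : ∀ (a : A) (n : ℕ) (p q : Fin n → A), left.γ a = ∑ i, Bal.tmul (p i) (q i) →
    ∑ i, S (p i) * q i = right.s (right.π a)
  antipode_right : ∀ (a : A) (n : ℕ) (p q : Fin n → A), right.γ a = ∑ i, Bal.tmul (p i) (q i) →
    ∑ i, p i * S (q i) = left.s (left.π a)

/-! ### Additive bicategories, Frobenius 1-morphisms, depth 2 -/

/-- A bicategory enriched over abelian groups: vertical and horizontal composition are biadditive. -/
class PreadditiveBicategory (C : Type u) [Bicategory.{w, v} C] where
  preadditive : ∀ a b : C, Preadditive (a ⟶ b)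
  whiskerLeft_add : ∀ {a b c : C} (f : a ⟶ b) {g h : b ⟶ c} (η θ : g ⟶ h),
    f ◁ (η + θ) = f ◁ η + f ◁ θ
  add_whiskerRight : ∀ {a b c : C} {f g : a ⟶ b} (η θ : f ⟶ g) (h : b ⟶ c),
    (η + θ) ▷ h = η ▷ h + θ ▷ h

attribute [reducible, instance] PreadditiveBicategory.preadditive

/-- An additive bicategory: moreover there are zero 1-morphisms and direct sums of 1-morphisms. -/
class AdditiveBicategory (C : Type u) [Bicategory.{w, v} C] extends PreadditiveBicategory C where
  hasFiniteBiproducts : ∀ a b : C, HasFiniteBiproducts (a ⟶ b)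

attribute [instance] AdditiveBicategory.hasFiniteBiproducts

section Frobenius

variable {C : Type u} [Bicategory.{w, v} C] {a b : C}

/-- `ῑ` is a two-sided dual of `ι`, with chosen duality 2-morphisms. The horizontal composite
`ι × ῑ` is written `ι ≫ ῑ` (left to right), and `x ∘ y` is `y ≫ x`. -/
structure TwoSidedDual (ι : a ⟶ b) (ῑ : b ⟶ a) where
  left : Bicategory.Adjunction ι ῑ
  right : Bicategory.Adjunction ῑ ι

namespace TwoSidedDual

variable {ι : a ⟶ b} {ῑ : b ⟶ a} (D : TwoSidedDual ι ῑ)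

/-- `ev_L : ῑ × ι → 1` -/
def evL : ῑ ≫ ι ⟶ 𝟙 b := D.left.counit

/-- `coev_L : 1 → ι × ῑ` -/
def coevL : 𝟙 a ⟶ ι ≫ ῑ := D.left.unit

/-- `ev_R : ι × ῑ → 1` -/
def evR : ι ≫ ῑ ⟶ 𝟙 a := D.right.counit

/-- `coev_R : 1 → ῑ × ι` -/
def coevR : 𝟙 b ⟶ ῑ ≫ ι := D.right.unit

/-- The convolution product on `A = End (ι × ῑ)`. -/
def convA (a₁ a₂ : End (ι ≫ ῑ)) : End (ι ≫ ῑ) :=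
  (ρ_ ι).inv ▷ ῑ ≫ (ι ◁ D.coevR) ▷ ῑ ≫ (α_ ι ῑ ι).inv ▷ ῑ ≫ (α_ (ι ≫ ῑ) ι ῑ).hom ≫
    (a₁ ▷ (ι ≫ ῑ) ≫ (ι ≫ ῑ) ◁ a₂) ≫
    (α_ (ι ≫ ῑ) ι ῑ).inv ≫ (α_ ι ῑ ι).hom ▷ ῑ ≫ (ι ◁ D.evL) ▷ ῑ ≫ (ρ_ ι).hom ▷ ῑ

/-- The convolution product on `B = End (ῑ × ι)`. -/
def convB (b₁ b₂ : End (ῑ ≫ ι)) : End (ῑ ≫ ι) :=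
  ῑ ◁ (λ_ ι).inv ≫ ῑ ◁ (D.coevL ▷ ι) ≫ ῑ ◁ (α_ ι ῑ ι).hom ≫ (α_ ῑ ι (ῑ ≫ ι)).inv ≫
    (b₁ ▷ (ῑ ≫ ι) ≫ (ῑ ≫ ι) ◁ b₂) ≫
    (α_ ῑ ι (ῑ ≫ ι)).hom ≫ ῑ ◁ (α_ ι ῑ ι).inv ≫ ῑ ◁ (D.evR ▷ ι) ≫ ῑ ◁ (λ_ ι).hom

/-- The Fourier transform `F : A → B`. -/
def fourier (x : End (ι ≫ ῑ)) : End (ῑ ≫ ι) :=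
  (λ_ (ῑ ≫ ι)).inv ≫ D.coevR ▷ (ῑ ≫ ι) ≫ (α_ (ῑ ≫ ι) ῑ ι).inv ≫ (α_ ῑ ι ῑ).hom ▷ ι ≫
    (ῑ ◁ x) ▷ ι ≫
    (α_ ῑ ι ῑ).inv ▷ ι ≫ (α_ (ῑ ≫ ι) ῑ ι).hom ≫ (ῑ ≫ ι) ◁ D.evL ≫ (ρ_ (ῑ ≫ ι)).hom

/-- The dotted Fourier transform `Ḟ : A → B`. -/
def fourierDot (x : End (ι ≫ ῑ)) : End (ῑ ≫ ι) :=
  (ρ_ (ῑ ≫ ι)).inv ≫ (ῑ ≫ ι) ◁ D.coevR ≫ (α_ ῑ ι (ῑ ≫ ι)).hom ≫ ῑ ◁ (α_ ι ῑ ι).inv ≫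
    ῑ ◁ (x ▷ ι) ≫
    ῑ ◁ (α_ ι ῑ ι).hom ≫ (α_ ῑ ι (ῑ ≫ ι)).inv ≫ D.evL ▷ (ῑ ≫ ι) ≫ (λ_ (ῑ ≫ ι)).hom

/-- The map `μ` from `L = End ι` to `R = End ῑ`. -/
def mu (l : End ι) : End ῑ :=
  (ρ_ ῑ).inv ≫ ῑ ◁ D.coevL ≫ (α_ ῑ ι ῑ).inv ≫ (ῑ ◁ l) ▷ ῑ ≫ D.evL ▷ ῑ ≫ (λ_ ῑ).hom

/-- The map `ν` from `L = End ι` to `R = End ῑ`. -/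
def nu (l : End ι) : End ῑ :=
  (λ_ ῑ).inv ≫ D.coevR ▷ ῑ ≫ (α_ ῑ ι ῑ).hom ≫ ῑ ◁ (l ▷ ῑ) ≫ ῑ ◁ D.evR ≫ (ρ_ ῑ).hom

/-- The Frobenius map `φ_L : A → L`. -/
def phiL (x : End (ι ≫ ῑ)) : End ι :=
  (ρ_ ι).inv ≫ ι ◁ D.coevR ≫ (α_ ι ῑ ι).inv ≫ x ▷ ι ≫ (α_ ι ῑ ι).hom ≫ ι ◁ D.evL ≫ (ρ_ ι).hom

/-- The element `i_A = coev_L ∘ ev_R` of `A`. -/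
def iA : End (ι ≫ ῑ) := D.evR ≫ D.coevL

/-- `∑ᵢ yᵢ ⊗ xᵢ` is a D2 quasi-basis for `ι`. -/
def IsQuasiBasis [PreadditiveBicategory C] {n : ℕ} (y x : Fin n → End (ι ≫ ῑ)) : Prop :=
  ∑ i, (x i ▷ ι ≫ (α_ ι ῑ ι).hom ≫ ι ◁ D.evL ≫ ι ◁ D.coevR ≫ (α_ ι ῑ ι).inv ≫ y i ▷ ι) =
    𝟙 ((ι ≫ ῑ) ≫ ι)

end TwoSidedDual

/-- The left depth 2 condition: `(ι × ῑ) × ι` is a direct summand (a retract) of a finite direct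
sum of copies of `ι`. -/
def IsLeftD2 [AdditiveBicategory C] (ι : a ⟶ b) (ῑ : b ⟶ a) : Prop :=
  ∃ n : ℕ, Nonempty (Retract ((ι ≫ ῑ) ≫ ι) (⨁ fun _ : Fin n => ι))

/-- Depth 2: the left condition together with the right one, that `(ῑ × ι) × ῑ` is a direct summand
of a finite direct sum of copies of `ῑ`. -/
def IsD2 [AdditiveBicategory C] (ι : a ⟶ b) (ῑ : b ⟶ a) : Prop :=
  IsLeftD2 ι ῑ ∧ IsLeftD2 ῑ ι

end Frobenius

/-! ### Functors adjoint on both sides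

Identities between natural transformations built from `F : X ⥤ Y`, `G : Y ⥤ X`, `F ⊣ G` and
`G ⊣ F`. They are the string diagram identities behind the Hopf algebroids, in a setting without
associators. -/

section Lift

variable {X Y Z W : Type*} [Category* X] [Category* Y] [Category* Z] [Category* W]
  {F : X ⥤ Y} {G : Y ⥤ X} (adj : F ⊣ G) (H : X ⥤ Z) (H' : Y ⥤ Z) (K : Z ⥤ W)

/-! The ring `A` carries two products, composition and convolution, and everything rests on how they
interact. A quarter turn of string diagrams (`fourier`, `fourierDot`) identifies `A` with `B` and
exchanges the two products. Composition of two quarter turns is the antipode, which therefore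
reverses both products.

A quasi-basis resolves the identity of `(ι × ῑ) × ι` through copies of `ι`. Inserted between two
convolutions stacked on each other, it gives `sum_convA_mul_convA`, an interchange law for the two
products; its rotated form is `sum_convA_mul`. Setting arguments equal to units in them shows that
multiplication by a fixed element distributes over convolution, with legs expressed by `y` and `x`.
These legs define the coproducts.

Thus `γ_L(a)` is characterised by pairing: evaluating it on `x, y` gives `a` composed with the
convolution of `x` and `y`. Such evaluations separate the points of the balanced tensor product
(`evalL_ext`, `evalR_ext`), so the bialgebroid axioms for `γ` become identities in `A`.
Coassociativity, pure or mixed, is associativity of convolution (`coassoc_of_casimir`), because each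
coproduct can be written with its argument convolved on either side. This part needs only the axioms
of `DoubleAlgebra` and `DistributiveFamily`, and serves both `A` and `B`.

Depth 2 and quasi-bases are the same data up to the duality bijections. Taking mates of a
quasi-basis for `ι` gives one for `ῑ`, hence right depth 2. The diagrammatic identities are proved
for a pair of functors adjoint on both sides, where no associators occur, and are carried back to
2-cells by the faithful action `f ↦ f ≫ ι`. -/

theorem map_unit_naturality {f g : X} (h : f ⟶ g) :
    H.map (adj.unit.app f) ≫ H.map (G.map (F.map h)) =
      H.map h ≫ H.map (adj.unit.app g) :=
  (H.map_comp _ _).symm.trans ((congrArg H.map (adj.unit_naturality h)).trans (H.map_comp _ _))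

theorem map_unit_naturality_assoc {f g : X} (h : f ⟶ g) {q : Z} (k : H.obj (G.obj (F.obj g)) ⟶ q) :
    H.map (adj.unit.app f) ≫ H.map (G.map (F.map h)) ≫ k =
      H.map h ≫ H.map (adj.unit.app g) ≫ k := by
  rw [← Category.assoc, map_unit_naturality, Category.assoc]

theorem map_counit_naturality {f g : Y} (h : f ⟶ g) :
    H'.map (F.map (G.map h)) ≫ H'.map (adj.counit.app g) =
      H'.map (adj.counit.app f) ≫ H'.map h :=
  (H'.map_comp _ _).symm.trans ((congrArg H'.map (adj.counit_naturality h)).trans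
    (H'.map_comp _ _))

theorem map_counit_naturality_assoc {f g : Y} (h : f ⟶ g) {q : Z} (k : H'.obj g ⟶ q) :
    H'.map (F.map (G.map h)) ≫ H'.map (adj.counit.app g) ≫ k =
      H'.map (adj.counit.app f) ≫ H'.map h ≫ k := by
  rw [← Category.assoc, map_counit_naturality, Category.assoc]

theorem map_left_triangle (f : X) :
    H'.map (F.map (adj.unit.app f)) ≫ H'.map (adj.counit.app (F.obj f)) =
      𝟙 _ :=
  (H'.map_comp _ _).symm.trans ((congrArg H'.map (adj.left_triangle_components f)).trans
    (H'.map_id _))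

theorem map_left_triangle_assoc (f : X) {q : Z} (k : H'.obj (F.obj f) ⟶ q) :
    H'.map (F.map (adj.unit.app f)) ≫ H'.map (adj.counit.app (F.obj f)) ≫ k =
      k :=
  (Category.assoc _ _ _).symm.trans
    ((congrArg (· ≫ k) (map_left_triangle adj H' f)).trans (Category.id_comp k))

theorem map_right_triangle (g : Y) :
    H.map (adj.unit.app (G.obj g)) ≫ H.map (G.map (adj.counit.app g)) =
      𝟙 _ :=
  (H.map_comp _ _).symm.trans ((congrArg H.map (adj.right_triangle_components g)).trans
    (H.map_id _))

theorem map_right_triangle_assoc (g : Y) {q : Z} (k : H.obj (G.obj g) ⟶ q) :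
    H.map (adj.unit.app (G.obj g)) ≫ H.map (G.map (adj.counit.app g)) ≫ k =
      k :=
  (Category.assoc _ _ _).symm.trans
    ((congrArg (· ≫ k) (map_right_triangle adj H g)).trans (Category.id_comp k))

/-- This is the case of the functor `H ⋙ K`. The separate form matches the nested images `K.map
(H.map _)` that occur in the diagrams. -/
theorem map_map_unit_naturality {f g : X} (h : f ⟶ g) :
    K.map (H.map (adj.unit.app f)) ≫ K.map (H.map (G.map (F.map h))) =
      K.map (H.map h) ≫ K.map (H.map (adj.unit.app g)) :=
  map_unit_naturality adj (H ⋙ K) h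

theorem map_map_unit_naturality_assoc {f g : X} (h : f ⟶ g) {q : W}
    (k : K.obj (H.obj (G.obj (F.obj g))) ⟶ q) :
    K.map (H.map (adj.unit.app f)) ≫ K.map (H.map (G.map (F.map h))) ≫ k =
      K.map (H.map h) ≫ K.map (H.map (adj.unit.app g)) ≫ k := by
  rw [← Category.assoc, map_map_unit_naturality, Category.assoc]

theorem map_map_counit_naturality {f g : Y} (h : f ⟶ g) :
    K.map (H'.map (F.map (G.map h))) ≫ K.map (H'.map (adj.counit.app g)) =
      K.map (H'.map (adj.counit.app f)) ≫ K.map (H'.map h) :=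
  map_counit_naturality adj (H' ⋙ K) h

theorem map_map_counit_naturality_assoc {f g : Y} (h : f ⟶ g) {q : W} (k : K.obj (H'.obj g) ⟶ q) :
    K.map (H'.map (F.map (G.map h))) ≫ K.map (H'.map (adj.counit.app g)) ≫ k =
      K.map (H'.map (adj.counit.app f)) ≫ K.map (H'.map h) ≫ k := by
  rw [← Category.assoc, map_map_counit_naturality, Category.assoc]

theorem map_map_left_triangle (f : X) :
    K.map (H'.map (F.map (adj.unit.app f))) ≫ K.map (H'.map (adj.counit.app (F.obj f))) =
      𝟙 _ :=
  map_left_triangle adj (H' ⋙ K) f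

theorem map_map_left_triangle_assoc (f : X) {q : W} (k : K.obj (H'.obj (F.obj f)) ⟶ q) :
    K.map (H'.map (F.map (adj.unit.app f))) ≫ K.map (H'.map (adj.counit.app (F.obj f))) ≫ k =
      k :=
  (Category.assoc _ _ _).symm.trans
    ((congrArg (· ≫ k) (map_map_left_triangle adj H' K f)).trans (Category.id_comp k))

variable (a : F ⋙ G ⟶ F ⋙ G) (l : F ⟶ F)

theorem pair_naturality {f g : X} (h : f ⟶ g) :
    G.map (F.map h) ≫ a.app g =
      a.app f ≫ G.map (F.map h) :=
  a.naturality h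

theorem pair_naturality_assoc {f g : X} (h : f ⟶ g) {q : X} (k : G.obj (F.obj g) ⟶ q) :
    G.map (F.map h) ≫ a.app g ≫ k =
      a.app f ≫ G.map (F.map h) ≫ k := by
  rw [← Category.assoc, pair_naturality, Category.assoc]

theorem map_pair_naturality {f g : X} (h : f ⟶ g) :
    H.map (G.map (F.map h)) ≫ H.map (a.app g) =
      H.map (a.app f) ≫ H.map (G.map (F.map h)) :=
  (H.map_comp _ _).symm.trans ((congrArg H.map (a.naturality h)).trans (H.map_comp _ _))

theorem map_pair_naturality_assoc {f g : X} (h : f ⟶ g) {q : Z} (k : H.obj (G.obj (F.obj g)) ⟶ q) :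
    H.map (G.map (F.map h)) ≫ H.map (a.app g) ≫ k =
      H.map (a.app f) ≫ H.map (G.map (F.map h)) ≫ k := by
  rw [← Category.assoc, map_pair_naturality, Category.assoc]

theorem map_map_pair_naturality {f g : X} (h : f ⟶ g) :
    K.map (H.map (G.map (F.map h))) ≫ K.map (H.map (a.app g)) =
      K.map (H.map (a.app f)) ≫ K.map (H.map (G.map (F.map h))) :=
  map_pair_naturality (H ⋙ K) a h

theorem map_map_pair_naturality_assoc {f g : X} (h : f ⟶ g) {q : W}
    (k : K.obj (H.obj (G.obj (F.obj g))) ⟶ q) :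
    K.map (H.map (G.map (F.map h))) ≫ K.map (H.map (a.app g)) ≫ k =
      K.map (H.map (a.app f)) ≫ K.map (H.map (G.map (F.map h))) ≫ k := by
  rw [← Category.assoc, map_map_pair_naturality, Category.assoc]

theorem map_naturality {f g : X} (h : f ⟶ g) :
    H'.map (F.map h) ≫ H'.map (l.app g) =
      H'.map (l.app f) ≫ H'.map (F.map h) :=
  (H'.map_comp _ _).symm.trans ((congrArg H'.map (l.naturality h)).trans (H'.map_comp _ _))

theorem map_naturality_assoc {f g : X} (h : f ⟶ g) {q : Z} (k : H'.obj (F.obj g) ⟶ q) :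
    H'.map (F.map h) ≫ H'.map (l.app g) ≫ k =
      H'.map (l.app f) ≫ H'.map (F.map h) ≫ k := by
  rw [← Category.assoc, map_naturality, Category.assoc]

end Lift

/-- A pair of functors that are adjoint to each other on both sides. -/
structure FrobeniusPair {X Y : Type*} [Category* X] [Category* Y] (F : X ⥤ Y) (G : Y ⥤ X) where
  left : F ⊣ G
  right : G ⊣ F

namespace FrobeniusPair

variable {X Y : Type*} [Category* X] [Category* Y] {F : X ⥤ Y} {G : Y ⥤ X} (D : FrobeniusPair F G)

/-- The roles of the two functors interchanged. -/
def swap : FrobeniusPair G F := ⟨D.right, D.left⟩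

/-- The convolution product of transformations of `F ⋙ G`. -/
@[simps]
def conv (a₁ a₂ : F ⋙ G ⟶ F ⋙ G) : F ⋙ G ⟶ F ⋙ G where
  app f := G.map (D.right.unit.app (F.obj f)) ≫ G.map (F.map (a₁.app f)) ≫
    a₂.app (G.obj (F.obj f)) ≫ G.map (D.left.counit.app (F.obj f))
  naturality f g h := by
    simp only [Functor.comp_obj, Functor.comp_map, pair_naturality_assoc,
      ← map_unit_naturality_assoc, Functor.id_obj, map_map_pair_naturality_assoc,
      map_counit_naturality, Category.assoc]

/-- The clockwise quarter turn of a transformation of `F ⋙ G`. -/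
@[simps]
def fourier (a : F ⋙ G ⟶ F ⋙ G) : G ⋙ F ⟶ G ⋙ F where
  app g := F.map (G.map (D.right.unit.app g)) ≫ F.map (a.app (G.obj g)) ≫
    D.left.counit.app (F.obj (G.obj g))
  naturality f g h := by
    simp only [Functor.comp_obj, Functor.comp_map, ← map_map_unit_naturality_assoc,
      Functor.id_obj, map_pair_naturality_assoc, Adjunction.counit_naturality, Category.assoc]

/-- The anticlockwise quarter turn of a transformation of `F ⋙ G`. -/
@[simps]
def fourierDot (a : F ⋙ G ⟶ F ⋙ G) : G ⋙ F ⟶ G ⋙ F where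
  app g := D.right.unit.app (F.obj (G.obj g)) ≫ F.map (a.app (G.obj g)) ≫
    F.map (G.map (D.left.counit.app g))
  naturality f g h := by
    simp only [Functor.comp_obj, Functor.comp_map, ← Adjunction.unit_naturality_assoc,
      map_pair_naturality_assoc, map_map_counit_naturality, Functor.id_obj, Category.assoc]

/-- The conjugate of a transformation of `F` with respect to `F ⊣ G`. -/
@[simps]
def mu (l : F ⟶ F) : G ⟶ G where
  app g := D.left.unit.app (G.obj g) ≫ G.map (l.app (G.obj g)) ≫ G.map (D.left.counit.app g)
  naturality f g h := by
    simp only [Functor.comp_obj, ← Adjunction.unit_naturality_assoc, map_naturality_assoc,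
      map_counit_naturality, Functor.id_obj, Category.assoc]

/-- The conjugate of a transformation of `F` with respect to `G ⊣ F`. -/
@[simps]
def nu (l : F ⟶ F) : G ⟶ G where
  app g := G.map (D.right.unit.app g) ≫ G.map (l.app (G.obj g)) ≫ D.right.counit.app (G.obj g)
  naturality f g h := by
    simp only [Functor.comp_obj, ← map_unit_naturality_assoc, Functor.id_obj,
      map_naturality_assoc, Adjunction.counit_naturality, Category.assoc]

/-- The partial trace of a transformation of `F ⋙ G`. -/
@[simps]
def phiL (a : F ⋙ G ⟶ F ⋙ G) : F ⟶ F where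
  app f := D.right.unit.app (F.obj f) ≫ F.map (a.app f) ≫ D.left.counit.app (F.obj f)
  naturality f g h := by
    simp only [Functor.comp_obj, ← Adjunction.unit_naturality_assoc, map_pair_naturality_assoc,
      Adjunction.counit_naturality, Category.assoc]

/-- The unit of the convolution product. -/
@[simps]
def iA : F ⋙ G ⟶ F ⋙ G where
  app f := D.right.counit.app f ≫ D.left.unit.app f

/-! ### Diagram identities for convolution, conjugates and quarter turns. -/

variable (a b c : F ⋙ G ⟶ F ⋙ G) (l l' : F ⟶ F) (r r' : G ⟶ G)

theorem conv_assoc : D.conv (D.conv a b) c = D.conv a (D.conv b c) := by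
  ext f
  simp only [Functor.comp_obj, conv_app, pair_naturality_assoc, Functor.map_comp, Category.assoc, ←
    map_counit_naturality, Functor.id_obj, ← map_unit_naturality_assoc,
      map_map_pair_naturality_assoc]

theorem conv_iA : D.conv a D.iA = a := by
  ext f
  simp only [Functor.comp_obj, conv_app, iA_app, Functor.id_obj, Category.assoc,
    Adjunction.right_triangle_components, Category.comp_id, Adjunction.counit_naturality,
    Adjunction.left_triangle_components_assoc]

theorem iA_conv : D.conv D.iA a = a := by
  ext f
  simp only [Functor.comp_obj, conv_app, iA_app, Functor.id_obj, Functor.map_comp,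
    Category.assoc, map_right_triangle_assoc]
  simp only [pair_naturality_assoc, map_left_triangle, Functor.id_obj]
  exact Category.comp_id _

theorem conv_comp_whiskerRight :
    D.conv a b ≫ Functor.whiskerRight l G = D.conv (a ≫ Functor.whiskerRight l G) b := by
  ext f
  simp only [Functor.comp_obj, NatTrans.comp_app, conv_app, pair_naturality_assoc,
    Functor.whiskerRight_app,
    Category.assoc, Functor.map_comp, map_counit_naturality, Functor.id_obj]

theorem whiskerRight_comp_conv :
    Functor.whiskerRight l G ≫ D.conv a b = D.conv (Functor.whiskerRight l G ≫ a) b := by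
  ext f
  simp only [Functor.comp_obj, NatTrans.comp_app, Functor.whiskerRight_app, conv_app,
    Functor.map_comp, Category.assoc, map_unit_naturality_assoc]

theorem conv_comp_whiskerLeft :
    D.conv a b ≫ Functor.whiskerLeft F r = D.conv a (b ≫ Functor.whiskerLeft F r) := by
  ext f
  simp only [Functor.comp_obj, NatTrans.comp_app, conv_app, pair_naturality_assoc,
    Functor.whiskerLeft_app,
    Category.assoc, NatTrans.naturality, NatTrans.naturality_assoc]

theorem whiskerLeft_comp_conv :
    Functor.whiskerLeft F r ≫ D.conv a b = D.conv a (Functor.whiskerLeft F r ≫ b) := by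
  ext f
  simp only [Functor.comp_obj, NatTrans.comp_app, Functor.whiskerLeft_app, conv_app,
    pair_naturality_assoc,
    Category.assoc, NatTrans.naturality_assoc]

/-- The `F`-strand of the second factor is joined to the `G`-strand of the first by the counit of `F
⊣ G`. Sliding `l` around this arc conjugates it. At the other end the arc is the unit of `G ⊣ F`,
which produces `nu` instead of `mu`. -/
theorem conv_comp_whiskerRight_right :
    D.conv a (b ≫ Functor.whiskerRight l G) = D.conv (a ≫ Functor.whiskerLeft F (D.mu l)) b := by
  ext f
  simp only [Functor.comp_obj, conv_app, NatTrans.comp_app, Functor.whiskerRight_app,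
    Category.assoc, pair_naturality_assoc, map_naturality_assoc, Functor.whiskerLeft_app, mu_app,
    Functor.map_comp, map_counit_naturality, Functor.id_obj, map_counit_naturality_assoc,
    map_left_triangle_assoc]

theorem conv_whiskerRight_comp :
    D.conv a (Functor.whiskerRight l G ≫ b) = D.conv (Functor.whiskerLeft F (D.nu l) ≫ a) b := by
  ext f
  simp only [Functor.comp_obj, conv_app, NatTrans.comp_app, Functor.whiskerRight_app,
    Category.assoc, Functor.whiskerLeft_app, nu_app, Functor.map_comp, map_unit_naturality_assoc,
    map_right_triangle_assoc, ← map_naturality_assoc]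

theorem mu_comp : D.mu (l ≫ l') = D.mu l' ≫ D.mu l := by
  ext f
  simp only [mu_app, Functor.comp_obj, NatTrans.comp_app, Functor.map_comp, Category.assoc, ←
    Adjunction.unit_naturality_assoc, map_naturality_assoc]
  simp only [map_counit_naturality, Functor.comp_obj, Functor.id_obj,
    map_counit_naturality_assoc, map_left_triangle_assoc]

/-- Both maps conjugate with respect to `G ⊣ F`, in opposite directions, so the zigzags cancel. -/
theorem mu_swap_nu : D.swap.mu (D.nu l) = l := by
  ext f
  simp only [swap, mu_app, Functor.comp_obj, nu_app, Functor.map_comp, Category.assoc,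
    Adjunction.unit_naturality_assoc, Adjunction.right_triangle_components_assoc,
      ← NatTrans.naturality]

theorem nu_mu_swap : D.nu (D.swap.mu r) = r := by
  ext f
  simp only [swap, nu_app, Functor.comp_obj, mu_app, Functor.map_comp, Category.assoc,
    Adjunction.counit_naturality, Adjunction.counit_naturality_assoc,
    Adjunction.left_triangle_components_assoc, NatTrans.naturality_assoc,
    Adjunction.left_triangle_components, Category.comp_id]

theorem conv_id : D.conv a (𝟙 _) = Functor.whiskerRight (D.phiL a) G := by
  ext f
  simp only [Functor.comp_obj, conv_app, NatTrans.id_app, Category.id_comp,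
    Functor.whiskerRight_app, phiL_app, Functor.map_comp]

/-- This provides a left inverse of the source map and hence its injectivity. -/
theorem phiL_iA : D.phiL (D.iA ≫ Functor.whiskerRight l G) = l := by
  ext f
  simp only [phiL_app, Functor.comp_obj, NatTrans.comp_app, iA_app, Functor.id_obj,
    Functor.whiskerRight_app, Category.assoc, Functor.map_comp, Adjunction.counit_naturality,
    Adjunction.left_triangle_components_assoc, Adjunction.right_triangle_components_assoc]

/-- By duality a transformation from the identity to `F ⋙ G` is the unit of `F ⊣ G` followed by a
transformation of `F`. The convolution with the identity recovers that transformation for the unit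
followed by `a`. -/
theorem iA_conv_id : D.iA ≫ D.conv (D.iA ≫ a) (𝟙 _) = D.iA ≫ a := by
  ext f
  simp only [Functor.comp_obj, NatTrans.comp_app, iA_app, Functor.id_obj, conv_app,
    Category.assoc, Functor.map_comp, NatTrans.id_app, Category.id_comp,
    map_right_triangle_assoc, Adjunction.unit_naturality_assoc,
    Adjunction.right_triangle_components, Category.comp_id]

theorem fourierDot_swap_fourier : D.swap.fourierDot (D.fourier a) = a := by
  ext f
  simp only [Functor.comp_obj, swap, fourierDot_app, fourier_app, Functor.map_comp,
    Category.assoc, Adjunction.unit_naturality_assoc, Adjunction.right_triangle_components_assoc,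
    ← pair_naturality, map_right_triangle_assoc]

theorem fourier_fourierDot_swap (b) : D.fourier (D.swap.fourierDot b) = b := by
  ext f
  simp only [Functor.comp_obj, swap, fourier_app, fourierDot_app, Functor.map_comp,
    Category.assoc, Adjunction.counit_naturality, Adjunction.counit_naturality_assoc,
    Adjunction.left_triangle_components_assoc, pair_naturality_assoc, map_left_triangle,
    Functor.id_obj,
    Category.comp_id]

/-- A quarter turn makes diagrams placed side by side into diagrams placed one above the other. The
opposite turn yields the opposite order. -/
theorem fourier_conv : D.fourier (D.conv a b) = D.fourier b ≫ D.fourier a := by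
  ext f
  simp only [Functor.comp_obj, fourier_app, conv_app, pair_naturality_assoc, Functor.map_comp,
    Category.assoc, ← map_map_unit_naturality_assoc, map_pair_naturality_assoc, NatTrans.comp_app, ←
    Adjunction.counit_naturality]

theorem fourierDot_conv : D.fourierDot (D.conv a b) = D.fourierDot a ≫ D.fourierDot b := by
  ext f
  simp only [Functor.comp_obj, fourierDot_app, conv_app, pair_naturality_assoc, Functor.map_comp,
    Category.assoc, ← map_map_counit_naturality, Functor.id_obj, NatTrans.comp_app, ←
    Adjunction.unit_naturality_assoc, map_pair_naturality_assoc]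

/-- After the `fourierDot` turn is undone, this and the next identity say how the antipode exchanges
the two base rings. -/
theorem fourier_whiskerLeft_mu :
    D.fourier (Functor.whiskerLeft F (D.mu l)) = D.fourierDot (Functor.whiskerRight l G) := by
  ext f
  simp only [Functor.comp_obj, fourier_app, Functor.whiskerLeft_app, mu_app, Functor.map_comp,
    Category.assoc, Adjunction.counit_naturality, Adjunction.counit_naturality_assoc,
    Adjunction.left_triangle_components_assoc, NatTrans.naturality_assoc, fourierDot_app,
    Functor.whiskerRight_app, Adjunction.unit_naturality_assoc, Adjunction.unit_naturality]

theorem fourier_whiskerRight :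
    D.fourier (Functor.whiskerRight l G) = D.fourierDot (Functor.whiskerLeft F (D.nu l)) := by
  ext f
  simp only [Functor.comp_obj, fourier_app, Functor.whiskerRight_app,
    Adjunction.counit_naturality, Adjunction.counit_naturality_assoc, fourierDot_app,
    Functor.whiskerLeft_app, nu_app, Functor.map_comp, Category.assoc,
    Adjunction.unit_naturality_assoc, Adjunction.right_triangle_components_assoc,
    ← NatTrans.naturality]

theorem fourier_whiskerRight_comp_iA :
    D.fourier (Functor.whiskerRight l G ≫ D.iA) = Functor.whiskerRight (D.nu l) F := by
  ext f
  simp only [Functor.comp_obj, fourier_app, NatTrans.comp_app, Functor.whiskerRight_app, iA_app,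
    Functor.id_obj, Functor.map_comp, Category.assoc, Adjunction.left_triangle_components,
    Category.comp_id, nu_app]

theorem fourierDot_whiskerRight_comp_iA :
    D.fourierDot (Functor.whiskerRight l G ≫ D.iA) = Functor.whiskerLeft G l := by
  ext f
  simp only [Functor.comp_obj, fourierDot_app, NatTrans.comp_app, Functor.whiskerRight_app,
    iA_app, Functor.id_obj, Functor.map_comp, Category.assoc, map_right_triangle,
    Category.comp_id, Adjunction.unit_naturality_assoc, Adjunction.right_triangle_components,
    Functor.whiskerLeft_app]

/-- The transformation `F ⋙ G ⋙ F ⟶ F` that corresponds to `x`. -/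
@[simps]
def bend (x : F ⋙ G ⟶ F ⋙ G) : F ⋙ G ⋙ F ⟶ F where
  app f := F.map (x.app f) ≫ D.left.counit.app (F.obj f)
  naturality f g h := by
    dsimp
    simp only [map_pair_naturality_assoc, Adjunction.counit_naturality, Category.assoc]

/-- The transformation `F ⟶ F ⋙ G ⋙ F` that corresponds to `y`. -/
@[simps]
def cobend (y : F ⋙ G ⟶ F ⋙ G) : F ⟶ F ⋙ G ⋙ F where
  app f := D.right.unit.app (F.obj f) ≫ F.map (y.app f)
  naturality f g h := by
    dsimp
    simp only [Category.assoc, ← map_pair_naturality, Functor.comp_obj,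
      Adjunction.unit_naturality_assoc]

/-- By naturality `x` and `y` can be brought together with only the joining arcs between them. What
remains in the middle is a single summand of a resolution of the identity. -/
theorem conv_comp_conv (a c x y z w : F ⋙ G ⟶ F ⋙ G) (f : X) :
    (D.conv (c ≫ x) z ≫ D.conv (y ≫ a) w).app f =
      (G.map (D.right.unit.app (F.obj f)) ≫ G.map (F.map (c.app f)) ≫ z.app _) ≫
        G.map ((D.bend x).app f ≫ (D.cobend y).app f) ≫ G.map (F.map (a.app f)) ≫ w.app _ ≫
          G.map (D.left.counit.app (F.obj f)) := by
  simp only [bend_app, cobend_app]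
  simp only [Functor.comp_obj, NatTrans.comp_app, conv_app, Functor.map_comp, Category.assoc,
    pair_naturality_assoc, Functor.id_obj, pair_naturality]

theorem sum_conv_comp_conv [Preadditive X] [Preadditive Y] [G.Additive] {n : ℕ}
    {x y : Fin n → (F ⋙ G ⟶ F ⋙ G)} {f : X}
    (h : ∑ i, (D.bend (x i)).app f ≫ (D.cobend (y i)).app f =
      𝟙 (F.obj (G.obj (F.obj f)))) (a c z w : F ⋙ G ⟶ F ⋙ G) :
    ∑ i, (D.conv (c ≫ x i) z ≫ D.conv (y i ≫ a) w).app f = (D.conv (c ≫ a) (z ≫ w)).app f := by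
  simp only [conv_comp_conv]
  rw [← Preadditive.comp_sum, ← Preadditive.sum_comp, ← G.map_sum,
    show G.map (∑ i, (D.bend (x i)).app f ≫ (D.cobend (y i)).app f) =
      𝟙 (G.obj (F.obj (G.obj (F.obj f)))) from (congrArg G.map h).trans (G.map_id _)]
  simp only [Functor.comp_obj, Category.id_comp, Category.assoc, conv_app, NatTrans.comp_app,
    pair_naturality_assoc, Functor.map_comp]

/-- `G ⋙ F ⋙ G` is left adjoint to `F ⋙ G ⋙ F`. -/
def tripleAdj : (G ⋙ F ⋙ G) ⊣ (F ⋙ G ⋙ F) := ((D.right.comp D.left).comp D.right)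

/-- Passing to mates turns the diagram: the `x`-leg undergoes three quarter turns and the `y`-leg,
in the next lemma, one. -/
theorem conj_bend (x : F ⋙ G ⟶ F ⋙ G) (g : Y) :
    ((conjugateEquiv D.tripleAdj D.right).symm (D.bend x)).app g =
      (D.swap.cobend (D.fourier (D.swap.fourier (D.fourier x)))).app g := by
  rw [conjugateEquiv_symm_apply_app]
  simp only [tripleAdj, Adjunction.comp_unit_app, bend_app, cobend_app]
  simp only [Functor.comp_obj, Functor.comp_map, Category.assoc, Functor.map_comp, swap,
    fourier_app, Adjunction.unit_naturality_assoc, Adjunction.right_triangle_components,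
    Category.comp_id]

theorem conj_cobend (y : F ⋙ G ⟶ F ⋙ G) (g : Y) :
    ((conjugateEquiv D.right D.tripleAdj).symm (D.cobend y)).app g =
      (D.swap.bend (D.fourier y)).app g := by
  rw [conjugateEquiv_symm_apply_app]
  simp only [tripleAdj, Adjunction.comp_counit_app, bend_app, cobend_app]
  simp only [Functor.comp_obj, Functor.comp_map, Functor.map_comp, Category.assoc,
    map_map_counit_naturality_assoc, map_map_left_triangle_assoc, fourier_app, swap]

/-- A dual basis for `F` yields one for `G`. -/

theorem sum_swap_bend_comp_cobend [Preadditive X] [Preadditive Y] [F.Additive] [G.Additive] {n : ℕ}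
    {x y : Fin n → (F ⋙ G ⟶ F ⋙ G)}
    (h : ∀ f, ∑ i, (D.bend (x i)).app f ≫ (D.cobend (y i)).app f =
      𝟙 (F.obj (G.obj (F.obj f)))) (g : Y) :
    ∑ i, (D.swap.bend (D.fourier (y i))).app g ≫
      (D.swap.cobend (D.fourier (D.swap.fourier (D.fourier (x i))))).app g =
      𝟙 (G.obj (F.obj (G.obj g))) := by
  -- Mates reverse composition, so each term is the mate of `bend` followed by `cobend`, and the sum
  -- is the mate of an identity.
  have key (i : Fin n) : (D.swap.bend (D.fourier (y i))).app g ≫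
      (D.swap.cobend (D.fourier (D.swap.fourier (D.fourier (x i))))).app g =
      (G ⋙ F ⋙ G).map (D.tripleAdj.unit.app g) ≫ (G ⋙ F ⋙ G).map
        ((D.bend (x i)).app _ ≫ (D.cobend (y i)).app _) ≫ D.tripleAdj.counit.app _ := by
    rw [← conj_bend, ← conj_cobend, ← NatTrans.comp_app, conjugateEquiv_symm_comp,
      conjugateEquiv_symm_apply_app, NatTrans.comp_app]
  simp only [key]
  rw [← Preadditive.comp_sum, ← Preadditive.sum_comp, ← Functor.map_sum, h]
  refine Eq.trans ?_ (D.tripleAdj.left_triangle_components g)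
  congr 1
  exact (congrArg (· ≫ _) ((G ⋙ F ⋙ G).map_id _)).trans (Category.id_comp _)

end FrobeniusPair

/-! ### From 2-cells to natural transformations

A 1-cell `ι : a ⟶ b` acts on the categories `x ⟶ a` by `f ↦ f ≫ ι`. This turns a two-sided dual
into a Frobenius pair of functors and 2-cells into natural transformations, faithfully. -/

section Transfer

open Bicategory

variable {C : Type u} [Bicategory.{w, v} C] {a b : C}

/-- The action of a 2-cell between composites of two 1-cells on `f`, reassociated. -/
def whiskerPair {x c : C} {f₁ f₂ : a ⟶ b} {g₁ g₂ : b ⟶ c} (θ : f₁ ≫ g₁ ⟶ f₂ ≫ g₂)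
    (f : x ⟶ a) : (f ≫ f₁) ≫ g₁ ⟶ (f ≫ f₂) ≫ g₂ :=
  (α_ f f₁ g₁).hom ≫ f ◁ θ ≫ (α_ f f₂ g₂).inv

theorem whiskerPair_naturality {x c : C} {f₁ f₂ : a ⟶ b} {g₁ g₂ : b ⟶ c}
    (θ : f₁ ≫ g₁ ⟶ f₂ ≫ g₂) {f g : x ⟶ a} (h : f ⟶ g) :
    h ▷ f₁ ▷ g₁ ≫ whiskerPair θ g = whiskerPair θ f ≫ h ▷ f₂ ▷ g₂ := by
  calc _ = 𝟙 _ ⊗≫ (h ▷ (f₁ ≫ g₁) ≫ g ◁ θ) ⊗≫ 𝟙 _ := by rw [whiskerPair]; bicategory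
    _ = _ := by rw [← whisker_exchange, whiskerPair]; bicategory

theorem whiskerPair_id {x c : C} (f₁ : a ⟶ b) (g₁ : b ⟶ c) (f : x ⟶ a) :
    whiskerPair (𝟙 (f₁ ≫ g₁)) f = 𝟙 _ := by
  simp [whiskerPair]

theorem whiskerPair_comp {x c : C} {f₁ f₂ f₃ : a ⟶ b} {g₁ g₂ g₃ : b ⟶ c}
    (θ : f₁ ≫ g₁ ⟶ f₂ ≫ g₂) (θ' : f₂ ≫ g₂ ⟶ f₃ ≫ g₃) (f : x ⟶ a) :
    whiskerPair (θ ≫ θ') f = whiskerPair θ f ≫ whiskerPair θ' f := by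
  simp [whiskerPair]

theorem whiskerLeft_id_injective {c : C} {f g : a ⟶ c} {θ θ' : f ⟶ g}
    (h : 𝟙 a ◁ θ = 𝟙 a ◁ θ') : θ = θ' := by
  simpa using h

theorem whiskerPair_injective {c : C} {f₁ f₂ : a ⟶ b} {g₁ g₂ : b ⟶ c}
    {θ θ' : f₁ ≫ g₁ ⟶ f₂ ≫ g₂} (h : whiskerPair θ (𝟙 a) = whiskerPair θ' (𝟙 a)) : θ = θ' := by
  rw [whiskerPair, whiskerPair, cancel_epi, cancel_mono] at h
  exact whiskerLeft_id_injective h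

/-- The natural transformation given by a 2-cell. -/
def act (x : C) {f g : a ⟶ b} (l : f ⟶ g) : postcomp x f ⟶ postcomp x g where
  app h := h ◁ l
  naturality _ _ h := (whisker_exchange h l).symm

/-- The natural transformation given by a 2-cell between composites of two 1-cells. -/
def actPair (x : C) {c : C} {f₁ f₂ : a ⟶ b} {g₁ g₂ : b ⟶ c} (θ : f₁ ≫ g₁ ⟶ f₂ ≫ g₂) :
    postcomp x f₁ ⋙ postcomp x g₁ ⟶ postcomp x f₂ ⋙ postcomp x g₂ where
  app f := whiskerPair θ f
  naturality _ _ h := whiskerPair_naturality θ h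

theorem act_injective {f g : a ⟶ b} {l l' : f ⟶ g} (h : act a l = act a l') : l = l' :=
  whiskerLeft_id_injective (NatTrans.congr_app h (𝟙 a))

/-- The component at `𝟙 a` is the 2-cell itself up to coherence isomorphisms. Hence identities
between 2-cells may be checked on natural transformations. -/
theorem actPair_injective {c : C} {f₁ f₂ : a ⟶ b} {g₁ g₂ : b ⟶ c}
    {θ θ' : f₁ ≫ g₁ ⟶ f₂ ≫ g₂} (h : actPair a θ = actPair a θ') : θ = θ' :=
  whiskerPair_injective (NatTrans.congr_app h (𝟙 a))

theorem act_comp (x : C) {f g h : a ⟶ b} (l : f ⟶ g) (l' : g ⟶ h) :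
    act x (l ≫ l') = act x l ≫ act x l' := by
  ext k
  exact Bicategory.whiskerLeft_comp k l l'

theorem actPair_id (x : C) {c : C} (f₁ : a ⟶ b) (g₁ : b ⟶ c) :
    actPair x (𝟙 (f₁ ≫ g₁)) = 𝟙 _ := by
  ext f
  exact whiskerPair_id f₁ g₁ f

theorem actPair_comp (x : C) {c : C} {f₁ f₂ f₃ : a ⟶ b} {g₁ g₂ g₃ : b ⟶ c}
    (θ : f₁ ≫ g₁ ⟶ f₂ ≫ g₂) (θ' : f₂ ≫ g₂ ⟶ f₃ ≫ g₃) :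
    actPair x (θ ≫ θ') = actPair x θ ≫ actPair x θ' := by
  ext f
  exact whiskerPair_comp θ θ' f

theorem actPair_whiskerRight (x : C) {c : C} {f₁ f₂ : a ⟶ b} (l : f₁ ⟶ f₂) (g : b ⟶ c) :
    actPair x (l ▷ g) = Functor.whiskerRight (act x l) (postcomp x g) := by
  ext f
  change whiskerPair (l ▷ g) f = (f ◁ l) ▷ g
  rw [whiskerPair]
  bicategory

theorem actPair_whiskerLeft (x : C) {c : C} (f : a ⟶ b) {g₁ g₂ : b ⟶ c} (r : g₁ ⟶ g₂) :
    actPair x (f ◁ r) = Functor.whiskerLeft (postcomp x f) (act x r) := by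
  ext h
  change whiskerPair (f ◁ r) h = (h ≫ f) ◁ r
  rw [whiskerPair]
  bicategory

/-! ### Adjunctions induced by dualities, and transfer of the constructions. -/

variable {ι : a ⟶ b} {ῑ : b ⟶ a}

/-- The unit of the adjunction induced by a duality, at `f`. -/
def whiskerUnit {x : C} (η : 𝟙 a ⟶ ι ≫ ῑ) (f : x ⟶ a) : f ⟶ (f ≫ ι) ≫ ῑ :=
  (ρ_ f).inv ≫ f ◁ η ≫ (α_ f ι ῑ).inv

/-- The counit of the adjunction induced by a duality, at `g`. -/
def whiskerCounit {x : C} (e : ῑ ≫ ι ⟶ 𝟙 b) (g : x ⟶ b) : (g ≫ ῑ) ≫ ι ⟶ g :=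
  (α_ g ῑ ι).hom ≫ g ◁ e ≫ (ρ_ g).hom

theorem whiskerUnit_naturality {x : C} (η : 𝟙 a ⟶ ι ≫ ῑ) {f g : x ⟶ a} (h : f ⟶ g) :
    h ≫ whiskerUnit η g = whiskerUnit η f ≫ h ▷ ι ▷ ῑ := by
  calc _ = 𝟙 _ ⊗≫ (h ▷ 𝟙 a ≫ g ◁ η) ⊗≫ 𝟙 _ := by rw [whiskerUnit]; bicategory
    _ = _ := by rw [← whisker_exchange, whiskerUnit]; bicategory

theorem whiskerCounit_naturality {x : C} (e : ῑ ≫ ι ⟶ 𝟙 b) {f g : x ⟶ b} (h : f ⟶ g) :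
    h ▷ ῑ ▷ ι ≫ whiskerCounit e g = whiskerCounit e f ≫ h := by
  calc _ = 𝟙 _ ⊗≫ (h ▷ (ῑ ≫ ι) ≫ g ◁ e) ⊗≫ 𝟙 _ := by rw [whiskerCounit]; bicategory
    _ = _ := by rw [← whisker_exchange, whiskerCounit]; bicategory

theorem whisker_left_triangle {x : C} (adj : Bicategory.Adjunction ι ῑ) (f : x ⟶ a) :
    whiskerUnit adj.unit f ▷ ι ≫ whiskerCounit adj.counit (f ≫ ι) = 𝟙 (f ≫ ι) := by
  calc _ = 𝟙 _ ⊗≫ f ◁ leftZigzag adj.unit adj.counit ⊗≫ 𝟙 _ := by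
        rw [whiskerUnit, whiskerCounit]; bicategory
    _ = _ := by rw [adj.left_triangle]; bicategory

theorem whisker_right_triangle {x : C} (adj : Bicategory.Adjunction ι ῑ) (g : x ⟶ b) :
    whiskerUnit adj.unit (g ≫ ῑ) ≫ whiskerCounit adj.counit g ▷ ῑ = 𝟙 (g ≫ ῑ) := by
  calc _ = 𝟙 _ ⊗≫ g ◁ rightZigzag adj.unit adj.counit ⊗≫ 𝟙 _ := by
        rw [whiskerUnit, whiskerCounit]; bicategory
    _ = _ := by rw [adj.right_triangle]; bicategory

/-- A duality of 1-cells induces an adjunction. -/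
def postcompAdj (x : C) (adj : Bicategory.Adjunction ι ῑ) : postcomp x ι ⊣ postcomp x ῑ where
  unit :=
    { app := whiskerUnit adj.unit
      naturality := fun _ _ => whiskerUnit_naturality adj.unit }
  counit :=
    { app := whiskerCounit adj.counit
      naturality := fun _ _ => whiskerCounit_naturality adj.counit }
  left_triangle_components f := whisker_left_triangle adj f
  right_triangle_components f := whisker_right_triangle adj f

namespace TwoSidedDual

variable (D : TwoSidedDual ι ῑ)

/-- The roles of `ι` and `ῑ` interchanged. -/
def swap : TwoSidedDual ῑ ι := ⟨D.right, D.left⟩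

/-- The Frobenius pair of functors given by a two-sided dual. -/
def pair (x : C) : FrobeniusPair (postcomp x ι) (postcomp x ῑ) :=
  ⟨postcompAdj x D.left, postcompAdj x D.right⟩

theorem pair_swap (x : C) : D.swap.pair x = (D.pair x).swap := rfl

/-- The two differ only in bracketing, so what is proved for `A` applies to `B` through the swapped
dual. -/
theorem convA_swap (b₁ b₂ : ῑ ≫ ι ⟶ ῑ ≫ ι) : D.swap.convA b₁ b₂ = D.convB b₁ b₂ := by
  simp only [convA, convB, swap, evL, coevR, evR, coevL]
  bicategory

/-- Once components are spelled out, the two sides are the same diagram up to coherence. The same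
holds for the other constructions below. -/
theorem actPair_convA (x : C) (a₁ a₂ : ι ≫ ῑ ⟶ ι ≫ ῑ) :
    actPair x (D.convA a₁ a₂) = (D.pair x).conv (actPair x a₁) (actPair x a₂) := by
  ext f
  change whiskerPair (D.convA a₁ a₂) f = whiskerUnit D.right.unit (f ≫ ι) ▷ ῑ ≫
    whiskerPair a₁ f ▷ ι ▷ ῑ ≫ whiskerPair a₂ ((f ≫ ι) ≫ ῑ) ≫
      whiskerCounit D.left.counit (f ≫ ι) ▷ ῑ
  simp only [whiskerPair, convA, whiskerUnit, whiskerCounit, coevR, evL]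
  bicategory

theorem actPair_fourier (x : C) (a₁ : ι ≫ ῑ ⟶ ι ≫ ῑ) :
    actPair x (D.fourier a₁) = (D.pair x).fourier (actPair x a₁) := by
  ext g
  change whiskerPair (D.fourier a₁) g = whiskerUnit D.right.unit g ▷ ῑ ▷ ι ≫
    whiskerPair a₁ (g ≫ ῑ) ▷ ι ≫ whiskerCounit D.left.counit ((g ≫ ῑ) ≫ ι)
  simp only [whiskerPair, fourier, whiskerUnit, whiskerCounit, coevR, evL]
  bicategory

theorem actPair_fourierDot (x : C) (a₁ : ι ≫ ῑ ⟶ ι ≫ ῑ) :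
    actPair x (D.fourierDot a₁) = (D.pair x).fourierDot (actPair x a₁) := by
  ext g
  change whiskerPair (D.fourierDot a₁) g = whiskerUnit D.right.unit ((g ≫ ῑ) ≫ ι) ≫
    whiskerPair a₁ (g ≫ ῑ) ▷ ι ≫ whiskerCounit D.left.counit g ▷ ῑ ▷ ι
  simp only [whiskerPair, fourierDot, whiskerUnit, whiskerCounit, coevR, evL]
  bicategory

theorem act_mu (x : C) (l : ι ⟶ ι) : act x (D.mu l) = (D.pair x).mu (act x l) := by
  ext g
  change g ◁ D.mu l = whiskerUnit D.left.unit (g ≫ ῑ) ≫ ((g ≫ ῑ) ◁ l) ▷ ῑ ≫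
    whiskerCounit D.left.counit g ▷ ῑ
  simp only [mu, whiskerUnit, whiskerCounit, coevL, evL]
  bicategory

theorem act_nu (x : C) (l : ι ⟶ ι) : act x (D.nu l) = (D.pair x).nu (act x l) := by
  ext g
  change g ◁ D.nu l = whiskerUnit D.right.unit g ▷ ῑ ≫ ((g ≫ ῑ) ◁ l) ▷ ῑ ≫
    whiskerCounit D.right.counit (g ≫ ῑ)
  simp only [nu, whiskerUnit, whiskerCounit, coevR, evR]
  bicategory

theorem act_phiL (x : C) (a₁ : ι ≫ ῑ ⟶ ι ≫ ῑ) :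
    act x (D.phiL a₁) = (D.pair x).phiL (actPair x a₁) := by
  ext f
  change f ◁ D.phiL a₁ = whiskerUnit D.right.unit (f ≫ ι) ≫ whiskerPair a₁ f ▷ ι ≫
    whiskerCounit D.left.counit (f ≫ ι)
  simp only [phiL, whiskerPair, whiskerUnit, whiskerCounit, coevR, evL]
  bicategory

theorem actPair_iA (x : C) : actPair x D.iA = (D.pair x).iA := by
  ext f
  change whiskerPair D.iA f = whiskerCounit D.right.counit f ≫ whiskerUnit D.left.unit f
  simp only [iA, whiskerPair, whiskerUnit, whiskerCounit, coevL, evR]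
  bicategory

/-- One term of the sum that defines a quasi-basis. -/
def basisTerm (x y : ι ≫ ῑ ⟶ ι ≫ ῑ) : (ι ≫ ῑ) ≫ ι ⟶ (ι ≫ ῑ) ≫ ι :=
  x ▷ ι ≫ (α_ ι ῑ ι).hom ≫ ι ◁ D.evL ≫ ι ◁ D.coevR ≫ (α_ ι ῑ ι).inv ≫ y ▷ ι

/-- The coherence isomorphism relating `f ≫ ((ι ≫ ῑ) ≫ ι)` to `((f ≫ ι) ≫ ῑ) ≫ ι`. -/
def tripleIso {x : C} (f : x ⟶ a) : ((f ≫ ι) ≫ ῑ) ≫ ι ≅ f ≫ (ι ≫ ῑ) ≫ ι :=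
  whiskerRightIso (α_ f ι ῑ) ι ≪≫ α_ f (ι ≫ ῑ) ι

theorem whiskerLeft_basisTerm {z : C} (x y : ι ≫ ῑ ⟶ ι ≫ ῑ) (f : z ⟶ a) :
    (tripleIso f).hom ≫ f ◁ D.basisTerm x y ≫ (tripleIso f).inv =
      ((D.pair z).bend (actPair z x)).app f ≫ ((D.pair z).cobend (actPair z y)).app f := by
  change _ = (whiskerPair x f ▷ ι ≫ whiskerCounit D.left.counit (f ≫ ι)) ≫
    (whiskerUnit D.right.unit (f ≫ ι) ≫ whiskerPair y f ▷ ι)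
  simp only [tripleIso, basisTerm, whiskerPair, whiskerUnit, whiskerCounit, coevR, evL,
    Iso.trans_hom, Iso.trans_inv, whiskerRightIso_hom, whiskerRightIso_inv]
  bicategory

end TwoSidedDual
end Transfer

/-! ### Maps out of balanced tensor products -/

section BalancedMaps

variable {R R' M N P : Type*} [AddCommGroup M] [AddCommGroup N] [AddCommGroup P]

namespace Bal

variable {ρ : R → M → M} {lam : R → N → N}

/-- `Bal.tmul` as a biadditive map. -/
def tmulHom (ρ : R → M → M) (lam : R → N → N) : M →+ N →+ Bal ρ lam :=
  AddMonoidHom.mk' (fun m => AddMonoidHom.mk' (fun n => tmul m n) fun n n' => by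
    simp [tmul, TensorProduct.tmul_add]) fun m m' => by
      ext n
      simp [tmul, TensorProduct.add_tmul]

@[simp]
theorem tmulHom_apply (m : M) (n : N) : tmulHom ρ lam m n = tmul m n := rfl

theorem tmul_sum {κ : Type*} (s : Finset κ) (m : M) (n : κ → N) :
    (tmul m (∑ i ∈ s, n i) : Bal ρ lam) = ∑ i ∈ s, tmul m (n i) :=
  map_sum (tmulHom ρ lam m) n s

theorem tmul_balanced (r : R) (m : M) (n : N) :
    (tmul (ρ r m) n : Bal ρ lam) = tmul m (lam r n) := by
  rw [← sub_eq_zero]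
  exact (QuotientAddGroup.eq_zero_iff _).2 (AddSubgroup.subset_closure ⟨r, m, n, rfl⟩)

/-- The map out of `M ⊗_R N` given by a balanced biadditive map. -/
def lift (f : M →+ N →+ P) (hf : ∀ r m n, f (ρ r m) n = f m (lam r n)) : Bal ρ lam →+ P :=
  QuotientAddGroup.lift (balRel ρ lam)
    (TensorProduct.liftAddHom f fun r m n => by simp)
    ((AddSubgroup.closure_le _).2 (by
      rintro _ ⟨r, m, n, rfl⟩
      simp [hf]))

@[simp]
theorem lift_tmul (f : M →+ N →+ P) (hf : ∀ r m n, f (ρ r m) n = f m (lam r n)) (m : M) (n : N) :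
    lift f hf (tmul m n) = f m n :=
  rfl

theorem hom_ext {f g : Bal ρ lam →+ P} (h : ∀ m n, f (tmul m n) = g (tmul m n)) : f = g := by
  refine DFunLike.ext _ _ fun z => ?_
  obtain ⟨n, p, q, rfl⟩ := z.exists_rep
  simp only [map_sum, h]

end Bal

variable {ρ₂ : R' → N → N} {lam₃ : R' → P → P} {ρ₁ : R → M → M} {lam₂ : R → N → N}

/-- The element `m ⊗ n ⊗ p` of a triple tensor product, as a triadditive map. -/
def Bal₃.tmulHom (ρ₁ : R → M → M) (lam₂ : R → N → N) (ρ₂ : R' → N → N) (lam₃ : R' → P → P) :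
    M →+ N →+ P →+ Bal₃ ρ₁ lam₂ ρ₂ lam₃ :=
  AddMonoidHom.mk' (fun m => AddMonoidHom.mk' (fun n => AddMonoidHom.mk' (fun p =>
    QuotientAddGroup.mk' (balRel₃ ρ₁ lam₂ ρ₂ lam₃) (m ⊗ₜ[ℤ] (n ⊗ₜ[ℤ] p)))
      fun p p' => by simp [TensorProduct.tmul_add])
      fun n n' => by ext p; simp [TensorProduct.tmul_add, TensorProduct.add_tmul])
      fun m m' => by ext n p; simp [TensorProduct.add_tmul]

theorem Bal₃.tmulHom_balanced_left (r : R) (m : M) (n : N) (p : P) :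
    Bal₃.tmulHom ρ₁ lam₂ ρ₂ lam₃ (ρ₁ r m) n p = Bal₃.tmulHom ρ₁ lam₂ ρ₂ lam₃ m (lam₂ r n) p := by
  rw [← sub_eq_zero]
  exact (QuotientAddGroup.eq_zero_iff _).2 (AddSubgroup.subset_closure (Or.inl ⟨r, m, n, p, rfl⟩))

theorem Bal₃.tmulHom_balanced_right (r : R') (m : M) (n : N) (p : P) :
    Bal₃.tmulHom ρ₁ lam₂ ρ₂ lam₃ m (ρ₂ r n) p = Bal₃.tmulHom ρ₁ lam₂ ρ₂ lam₃ m n (lam₃ r p) := by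
  rw [← sub_eq_zero]
  exact (QuotientAddGroup.eq_zero_iff _).2 (AddSubgroup.subset_closure (Or.inr ⟨r, m, n, p, rfl⟩))

theorem Bal.tmulRight_sum_tmul {κ : Type*} (s : Finset κ) (m : κ → M) (n : κ → N) (p : P) :
    (Bal.tmulRight (∑ i ∈ s, Bal.tmul (m i) (n i)) p : Bal₃ ρ₁ lam₂ ρ₂ lam₃) =
      ∑ i ∈ s, Bal₃.tmulHom ρ₁ lam₂ ρ₂ lam₃ (m i) (n i) p :=
  map_sum (QuotientAddGroup.lift (balRel ρ₁ lam₂)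
    ((QuotientAddGroup.mk' (balRel₃ ρ₁ lam₂ ρ₂ lam₃)).comp
      (((TensorProduct.mk ℤ N P).flip p).lTensor M).toAddMonoidHom) _)
    (fun i => Bal.tmul (m i) (n i)) s

theorem Bal.tmulLeft_sum_tmul {κ : Type*} (s : Finset κ) (m : M) (n : κ → N) (p : κ → P) :
    (Bal.tmulLeft m (∑ i ∈ s, Bal.tmul (n i) (p i)) : Bal₃ ρ₁ lam₂ ρ₂ lam₃) =
      ∑ i ∈ s, Bal₃.tmulHom ρ₁ lam₂ ρ₂ lam₃ m (n i) (p i) :=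
  map_sum (QuotientAddGroup.lift (balRel ρ₂ lam₃)
    ((QuotientAddGroup.mk' (balRel₃ ρ₁ lam₂ ρ₂ lam₃)).comp
      (TensorProduct.mk ℤ M (N ⊗[ℤ] P) m).toAddMonoidHom) _)
    (fun i => Bal.tmul (n i) (p i)) s

/-- Coproducts of the form `z ↦ ∑ p ⊗ (q * z)` and `z ↦ ∑ (z * p') ⊗ q'`, for an associative
product `*`, satisfy every mixed coassociativity law. -/
theorem coassoc_of_casimir {A : Type*} [AddCommGroup A] {R R' : Type*} {ρ₁ lam₂ : R → A → A}
    {ρ₂ lam₃ : R' → A → A} (conv : A →+ A →+ A)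
    (conv_assoc : ∀ x y z, conv (conv x y) z = conv x (conv y z))
    (hρ : ∀ r x y, conv x (ρ₂ r y) = ρ₂ r (conv x y))
    (hlam : ∀ r x y, conv (lam₂ r x) y = lam₂ r (conv x y))
    (g₁ : A → Bal ρ₁ lam₂) (g₂ : A → Bal ρ₂ lam₃) {k : ℕ} {P Q P' Q' : Fin k → A}
    (hg₁ : ∀ z, g₁ z = ∑ j, Bal.tmul (P j) (conv (Q j) z))
    (hg₂ : ∀ z, g₂ z = ∑ j, Bal.tmul (conv z (P' j)) (Q' j))
    (a : A) {n : ℕ} {p q : Fin n → A} {m : ℕ} {p' q' : Fin m → A}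
    (h₂ : g₂ a = ∑ i, Bal.tmul (p i) (q i)) (h₁ : g₁ a = ∑ i, Bal.tmul (p' i) (q' i)) :
    (∑ i, Bal.tmulRight (g₁ (p i)) (q i) : Bal₃ ρ₁ lam₂ ρ₂ lam₃) =
      ∑ i, Bal.tmulLeft (p' i) (g₂ (q' i)) := by
  let T := Bal₃.tmulHom ρ₁ lam₂ ρ₂ lam₃
  -- `Φ` is `g₁ ⊗ id` and `Ψ` is `id ⊗ g₂`. Each uses the form of the coproduct for which
  -- balancedness is a linearity of `conv`.
  let Φ : Bal ρ₂ lam₃ →+ Bal₃ ρ₁ lam₂ ρ₂ lam₃ := Bal.lift (∑ j, (T (P j)).comp (conv (Q j)))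
    fun r x y => by
      simp only [AddMonoidHom.finsetSum_apply, AddMonoidHom.comp_apply, hρ]
      exact Finset.sum_congr rfl fun j _ => Bal₃.tmulHom_balanced_right _ _ _ _
  let Ψ : Bal ρ₁ lam₂ →+ Bal₃ ρ₁ lam₂ ρ₂ lam₃ := Bal.lift
    (AddMonoidHom.mk' (fun x => ∑ j, ((T x).flip (Q' j)).comp (conv.flip (P' j))) fun x y => by
      ext z; simp [Finset.sum_add_distrib])
    fun r x y => by
      simp only [AddMonoidHom.mk'_apply, AddMonoidHom.finsetSum_apply, AddMonoidHom.comp_apply,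
        AddMonoidHom.flip_apply, hlam]
      exact Finset.sum_congr rfl fun j _ => Bal₃.tmulHom_balanced_left _ _ _ _
  have hΦ := congrArg Φ (h₂.symm.trans (hg₂ a))
  have hΨ := congrArg Ψ (h₁.symm.trans (hg₁ a))
  simp only [map_sum, Φ, Ψ, Bal.lift_tmul, AddMonoidHom.mk'_apply, AddMonoidHom.finsetSum_apply,
    AddMonoidHom.comp_apply, AddMonoidHom.flip_apply] at hΦ hΨ
  simp only [hg₁, hg₂, Bal.tmulRight_sum_tmul, Bal.tmulLeft_sum_tmul]
  -- Both sides are sums of `P j ⊗ (Q j · a · P' i) ⊗ Q' i`, the dots standing for `conv`, and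
  -- differ only in brackets and order of summation.
  refine hΦ.trans (Eq.trans ?_ hΨ.symm)
  rw [Finset.sum_comm]
  simp only [conv_assoc, T]

end BalancedMaps

/-! ### Hopf algebroids from double algebras

The ring `A = End (ι × ῑ)` carries a second product, the convolution. The two products, their
compatibility with the base rings `L` and `R`, and distributivity laws with respect to a family
of elements are all that is needed to construct the Hopf algebroid. -/

/-- A ring `A` with a second associative product `conv`, base rings `L` and `R` and an antipode. -/
structure DoubleAlgebra (A L R : Type*) [Ring A] [Ring L] [Ring R] where
  /-- the second product -/
  conv : A →+ A →+ A
  /-- the unit of the second product -/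
  i : A
  /-- the inclusion of the left base ring -/
  s : L →+* A
  /-- the inclusion of the right base ring -/
  u : R →+* A
  /-- the comparison of the base rings at the top -/
  μ : L ≃+* Rᵐᵒᵖ
  /-- the comparison of the base rings at the bottom -/
  ν : L ≃+* Rᵐᵒᵖ
  /-- the antipode -/
  S : A ≃+ A
  /-- the left counit -/
  π : A →+ L
  conv_assoc : ∀ x y z, conv (conv x y) z = conv x (conv y z)
  conv_i : ∀ x, conv x i = x
  i_conv : ∀ x, conv i x = x
  s_u_comm : ∀ l r, s l * u r = u r * s l
  s_mul_conv : ∀ l x y, s l * conv x y = conv (s l * x) y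
  conv_mul_s : ∀ l x y, conv x y * s l = conv (x * s l) y
  u_mul_conv : ∀ r x y, u r * conv x y = conv x (u r * y)
  conv_mul_u : ∀ r x y, conv x y * u r = conv x (y * u r)
  conv_s_mul : ∀ l x y, conv x (s l * y) = conv (u (unop (μ l)) * x) y
  conv_mul_s' : ∀ l x y, conv x (y * s l) = conv (x * u (unop (ν l))) y
  s_injective : Function.Injective s
  s_π : ∀ x, s (π x) = conv (x * i) 1
  s_π_mul_i : ∀ x, s (π x) * i = x * i
  S_mul : ∀ x y, S (x * y) = S y * S x
  S_conv : ∀ x y, S (conv x y) = conv (S y) (S x)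
  S_u : ∀ l, S (u (unop (μ l))) = s l
  S_s : ∀ l, S (s l) = u (unop (ν l))

/-- Families of elements that make the multiplication of a double algebra distribute over the
convolution product, from the left and from the right. -/
structure DistributiveFamily {A L R : Type*} [Ring A] [Ring L] [Ring R] (D : DoubleAlgebra A L R)
    (n : ℕ) where
  /-- the legs of the left coproduct of the convolution unit -/
  (p q : Fin n → A)
  /-- the legs of the right coproduct of the convolution unit -/
  (p' q' : Fin n → A)
  mul_conv : ∀ a x y, a * D.conv x y = ∑ k, D.conv (D.conv a (p k) * x) (q k * y)
  mul_conv' : ∀ a x y, a * D.conv x y = ∑ k, D.conv (p k * x) (D.conv (q k) a * y)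
  conv_mul : ∀ a x y, D.conv x y * a = ∑ k, D.conv (x * D.conv a (p' k)) (y * q' k)
  conv_mul' : ∀ a x y, D.conv x y * a = ∑ k, D.conv (x * p' k) (y * D.conv (q' k) a)
  antipode_left : ∀ a, ∑ k, D.S (p k) * D.conv (q k) a = D.conv 1 (D.i * a)
  antipode_right : ∀ a, ∑ k, D.conv a (p' k) * D.S (q' k) = D.conv (a * D.i) 1

/-! ### Counits, target maps and evaluations in a double algebra. -/

namespace DoubleAlgebra

variable {A L R : Type*} [Ring A] [Ring L] [Ring R] (D : DoubleAlgebra A L R)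

/-- A base element can be slid from one factor of a convolution to the other. When both factors are
the unit `i`, the two embeddings become equal next to `i`. -/
theorem u_μ_mul_i (l : L) : D.u (unop (D.μ l)) * D.i = D.s l * D.i := by
  rw [← D.conv_i (D.u _ * D.i), ← D.conv_s_mul, D.i_conv]

theorem i_mul_u_ν (l : L) : D.i * D.u (unop (D.ν l)) = D.i * D.s l := by
  rw [← D.conv_i (D.i * D.u _), ← D.conv_mul_s', D.i_conv]

theorem S_one : D.S 1 = 1 := by
  have h : D.S 1 * D.S (D.S.symm 1) = 1 := by
    rw [← D.S_mul, mul_one, AddEquiv.apply_symm_apply]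
  simpa using h

theorem S_i : D.S D.i = D.i := by
  have h : D.conv (D.S D.i) (D.S (D.S.symm D.i)) = D.i := by
    rw [← D.S_conv, D.conv_i, AddEquiv.apply_symm_apply]
  simpa [D.conv_i] using h

theorem S_symm_mul (x y : A) : D.S.symm (x * y) = D.S.symm y * D.S.symm x := by
  rw [AddEquiv.symm_apply_eq, D.S_mul, AddEquiv.apply_symm_apply, AddEquiv.apply_symm_apply]

theorem S_symm_conv (x y : A) :
    D.S.symm (D.conv x y) = D.conv (D.S.symm y) (D.S.symm x) := by
  rw [AddEquiv.symm_apply_eq, D.S_conv, AddEquiv.apply_symm_apply, AddEquiv.apply_symm_apply]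

theorem S_symm_one : D.S.symm 1 = 1 := by
  rw [AddEquiv.symm_apply_eq, D.S_one]

theorem S_symm_i : D.S.symm D.i = D.i := by
  rw [AddEquiv.symm_apply_eq, D.S_i]

theorem u_injective : Function.Injective D.u := by
  intro r r' h
  have hs (r : R) : D.u r = D.S (D.s (D.ν.symm (op r))) := by
    rw [D.S_s, RingEquiv.apply_symm_apply, unop_op]
  rw [hs, hs] at h
  exact op_injective (D.ν.symm.injective (D.s_injective (D.S.injective h)))

/-- The right counit. -/
def πR : A →+ R :=
  AddMonoidHom.mk' (fun x => unop (D.ν (D.π (D.S.symm x)))) fun x y => by simp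

theorem πR_apply (x : A) : D.πR x = unop (D.ν (D.π (D.S.symm x))) := rfl

/-- This is the image of `s_π` under the antipode, which fixes `1` and `i` and reverses both
products. -/
theorem u_πR (x : A) : D.u (D.πR x) = D.conv 1 (D.i * x) := by
  rw [πR_apply, ← D.S_s, D.s_π, D.S_conv, D.S_mul, D.S_i, D.S_one, AddEquiv.apply_symm_apply]

theorem i_mul_u_πR (x : A) : D.i * D.u (D.πR x) = D.i * x := by
  have h := congrArg D.S (D.s_π_mul_i (D.S.symm x))
  rwa [D.S_mul, D.S_mul, D.S_i, D.S_s, AddEquiv.apply_symm_apply] at h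

/-- The target map of the left bialgebroid. -/
def tL : Lᵐᵒᵖ →+* A where
  toFun l := D.u (unop (D.μ (unop l)))
  map_one' := by simp
  map_mul' l m := by simp
  map_zero' := by simp
  map_add' l m := by simp

/-- The target map of the right bialgebroid. -/
def tR : Rᵐᵒᵖ →+* A := D.s.comp D.ν.symm.toRingHom

theorem tL_op (l : L) : D.tL (op l) = D.u (unop (D.μ l)) := rfl

theorem tR_apply (r : Rᵐᵒᵖ) : D.tR r = D.s (D.ν.symm r) := rfl

/-- Next to `i` an element acts only through its counit. Evaluating coproducts at `i` therefore
yields the counit laws and the dual bases over the base rings. -/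
theorem conv_mul_i (a c : A) : D.conv a (c * D.i) = D.tL (op (D.π c)) * a := by
  rw [← D.s_π_mul_i, D.conv_s_mul, D.conv_i, tL_op]

theorem mul_i_conv (a c : A) : D.conv (c * D.i) a = D.s (D.π c) * a := by
  rw [← D.s_π_mul_i, ← D.s_mul_conv, D.i_conv]

theorem conv_i_mul (a c : A) : D.conv a (D.i * c) = a * D.u (D.πR c) := by
  rw [← D.i_mul_u_πR, ← D.conv_mul_u, D.conv_i]

theorem i_mul_conv (a c : A) : D.conv (D.i * c) a = a * D.tR (op (D.πR c)) := by
  have h : D.i * D.u (D.πR c) = D.i * D.tR (op (D.πR c)) := by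
    rw [tR_apply, ← D.i_mul_u_ν, RingEquiv.apply_symm_apply, unop_op]
  rw [← D.i_mul_u_πR, h, tR_apply, ← D.conv_mul_s, D.i_conv]

theorem conv_mul_tR (r : R) (x y : A) : D.conv x (y * D.tR (op r)) = D.conv (x * D.u r) y := by
  rw [tR_apply, D.conv_mul_s', RingEquiv.apply_symm_apply, unop_op]

theorem conv_actAL (l : L) (x y : A) :
    D.conv x (actAL D.tL l y) = actAL D.tL l (D.conv x y) :=
  (D.u_mul_conv _ x y).symm

theorem actLA_conv (l : L) (x y : A) :
    D.conv (actLA D.s l x) y = actLA D.s l (D.conv x y) :=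
  (D.s_mul_conv _ x y).symm

theorem conv_actAR (r : R) (x y : A) :
    D.conv x (actAR D.u r y) = actAR D.u r (D.conv x y) :=
  (D.conv_mul_u _ x y).symm

theorem actRA_conv (r : R) (x y : A) :
    D.conv (actRA D.tR r x) y = actRA D.tR r (D.conv x y) :=
  (D.conv_mul_s _ x y).symm

/-- Evaluation of `a ⊗ b` as `(a x) * (b y)`. -/
def evalL (x y : A) : Bal (actAL D.tL) (actLA D.s) →+ A :=
  Bal.lift ((D.conv.compl₂ (AddMonoidHom.mulRight y)).comp (AddMonoidHom.mulRight x))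
    fun l a b => by
      simp [actAL, actLA, mul_assoc, D.conv_s_mul, tL_op]

/-- Evaluation of `a ⊗ b` as `(x a) * (y b)`. -/
def evalR (x y : A) : Bal (actAR D.u) (actRA D.tR) →+ A :=
  Bal.lift ((D.conv.compl₂ (AddMonoidHom.mulLeft y)).comp (AddMonoidHom.mulLeft x))
    fun r a b => by
      simp [actAR, actRA, ← mul_assoc, D.conv_mul_tR]

theorem evalL_tmul (x y a b : A) : D.evalL x y (Bal.tmul a b) = D.conv (a * x) (b * y) := rfl

theorem evalR_tmul (x y a b : A) : D.evalR x y (Bal.tmul a b) = D.conv (x * a) (y * b) := rfl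

end DoubleAlgebra

/-! ### Coproducts determined by their evaluations. -/

namespace DistributiveFamily

variable {A L R : Type*} [Ring A] [Ring L] [Ring R] {D : DoubleAlgebra A L R} {n : ℕ}
  (E : DistributiveFamily D n)

/-- The distributive law at `i` and `1` makes the `q k` generators of `A` as a left `L`-module, with
coordinates `π (conv b (p k))`. -/
theorem sum_s_π_mul (b : A) : ∑ k, D.s (D.π (D.conv b (E.p k))) * E.q k = b := by
  have h := E.mul_conv b D.i 1
  simp only [D.i_conv, mul_one, D.mul_i_conv] at h
  exact h.symm

theorem sum_mul_tR (b : A) : ∑ k, E.q' k * D.tR (op (D.πR (D.conv b (E.p' k)))) = b := by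
  have h := E.conv_mul b D.i 1
  simp only [D.i_conv, one_mul, D.i_mul_conv] at h
  exact h.symm

/-- An element of `A_L ⊗ _L A` is determined by its evaluations. -/
theorem evalL_ext (E : DistributiveFamily D n) {z z' : Bal (actAL D.tL) (actLA D.s)}
    (h : ∀ y, D.evalL 1 y z = D.evalL 1 y z') : z = z' := by
  -- Built from evaluations alone, `c k` sends `a ⊗ b` to `a` acted on by the `k`-th coordinate of
  -- `b`; the right family supplies the law that shows it. Tensoring with `q k` and summing recovers
  -- `a ⊗ b`.
  let c (k : Fin n) : Bal (actAL D.tL) (actLA D.s) →+ A :=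
    ∑ j, (D.conv.flip (E.p k * E.q' j)).comp (D.evalL 1 (E.p' j))
  have hc : ∑ k, ((Bal.tmulHom (actAL D.tL) (actLA D.s)).flip (E.q k)).comp (c k) =
      AddMonoidHom.id _ := by
    refine Bal.hom_ext fun a b => ?_
    have hk (k : Fin n) : c k (Bal.tmul a b) = actAL D.tL (D.π (D.conv b (E.p k))) a := by
      have := E.conv_mul' D.i b (E.p k)
      simp only [D.conv_i] at this
      simp only [c, AddMonoidHom.finsetSum_apply, AddMonoidHom.comp_apply, D.evalL_tmul,
        AddMonoidHom.flip_apply, mul_one, D.conv_assoc]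
      rw [← map_sum, ← this, D.conv_mul_i, actAL]
    simp only [AddMonoidHom.finsetSum_apply, AddMonoidHom.comp_apply, hk, AddMonoidHom.flip_apply,
      Bal.tmulHom_apply, Bal.tmul_balanced, AddMonoidHom.id_apply]
    rw [← Bal.tmul_sum]
    exact congrArg _ (E.sum_s_π_mul b)
  have hz (z) := DFunLike.congr_fun hc z
  simp only [AddMonoidHom.finsetSum_apply, AddMonoidHom.comp_apply, AddMonoidHom.id_apply, c] at hz
  rw [← hz z, ← hz z']
  simp only [h]

/-- An element of `A^R ⊗ ^R A` is determined by its evaluations. -/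
theorem evalR_ext (E : DistributiveFamily D n) {z z' : Bal (actAR D.u) (actRA D.tR)}
    (h : ∀ y, D.evalR 1 y z = D.evalR 1 y z') : z = z' := by
  -- In this mirror image the left family computes the coordinates with respect to `q' k`.
  let c (k : Fin n) : Bal (actAR D.u) (actRA D.tR) →+ A :=
    ∑ j, (D.conv.flip (E.q j * E.p' k)).comp (D.evalR 1 (E.p j))
  have hc : ∑ k, ((Bal.tmulHom (actAR D.u) (actRA D.tR)).flip (E.q' k)).comp (c k) =
      AddMonoidHom.id _ := by
    refine Bal.hom_ext fun a b => ?_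
    have hk (k : Fin n) : c k (Bal.tmul a b) = actAR D.u (D.πR (D.conv b (E.p' k))) a := by
      have := E.mul_conv D.i b (E.p' k)
      simp only [D.i_conv] at this
      simp only [c, AddMonoidHom.finsetSum_apply, AddMonoidHom.comp_apply, D.evalR_tmul,
        AddMonoidHom.flip_apply, one_mul, D.conv_assoc]
      rw [← map_sum, ← this, D.conv_i_mul, actAR]
    simp only [AddMonoidHom.finsetSum_apply, AddMonoidHom.comp_apply, hk, AddMonoidHom.flip_apply,
      Bal.tmulHom_apply, Bal.tmul_balanced, AddMonoidHom.id_apply]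
    rw [← Bal.tmul_sum]
    exact congrArg _ (E.sum_mul_tR b)
  have hz (z) := DFunLike.congr_fun hc z
  simp only [AddMonoidHom.finsetSum_apply, AddMonoidHom.comp_apply, AddMonoidHom.id_apply, c] at hz
  rw [← hz z, ← hz z']
  simp only [h]

/-- The left coproduct. -/
def γL : A →+ Bal (actAL D.tL) (actLA D.s) :=
  ∑ k, ((Bal.tmulHom _ _).flip (E.q k)).comp (D.conv.flip (E.p k))

/-- The right coproduct. -/
def γR : A →+ Bal (actAR D.u) (actRA D.tR) :=
  ∑ k, ((Bal.tmulHom _ _).flip (E.q' k)).comp (D.conv.flip (E.p' k))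

theorem γL_apply (a : A) : E.γL a = ∑ k, Bal.tmul (D.conv a (E.p k)) (E.q k) := by
  simp [γL]

theorem γR_apply (a : A) : E.γR a = ∑ k, Bal.tmul (D.conv a (E.p' k)) (E.q' k) := by
  simp [γR]

/-- This is the distributive law read as a characterisation of the coproduct. As evaluations
separate points, multiplicativity of `γL` becomes associativity of composition. -/
theorem evalL_γL (x y a : A) : D.evalL x y (E.γL a) = a * D.conv x y := by
  rw [γL_apply, map_sum, E.mul_conv]
  rfl

theorem evalR_γR (x y a : A) : D.evalR x y (E.γR a) = D.conv x y * a := by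
  rw [γR_apply, map_sum, E.conv_mul]
  rfl

theorem γL_apply' (a : A) : E.γL a = ∑ k, Bal.tmul (E.p k) (D.conv (E.q k) a) := by
  refine E.evalL_ext fun y => ?_
  rw [evalL_γL, map_sum, E.mul_conv']
  rfl

theorem γR_apply' (a : A) : E.γR a = ∑ k, Bal.tmul (E.p' k) (D.conv (E.q' k) a) := by
  refine E.evalR_ext fun y => ?_
  rw [evalR_γR, map_sum, E.conv_mul']
  rfl

theorem sum_evalL {a : A} {m : ℕ} {p q : Fin m → A} (h : E.γL a = ∑ k, Bal.tmul (p k) (q k))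
    (x y : A) : ∑ k, D.conv (p k * x) (q k * y) = a * D.conv x y := by
  rw [← evalL_γL, h, map_sum]
  rfl

theorem sum_evalR {a : A} {m : ℕ} {p q : Fin m → A} (h : E.γR a = ∑ k, Bal.tmul (p k) (q k))
    (x y : A) : ∑ k, D.conv (x * p k) (y * q k) = D.conv x y * a := by
  rw [← evalR_γR, h, map_sum]
  rfl

/-- The left bialgebroid of a double algebra. -/
def leftBialgebroid : LeftBialgebroid A L where
  s := D.s
  t := D.tL
  γ := E.γL
  π := D.π
  comm l l' := D.s_u_comm _ _
  γ_left l a m p q h := by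
    refine E.evalL_ext fun y => ?_
    simp only [evalL_γL, map_sum, D.evalL_tmul, mul_assoc, ← D.s_mul_conv]
    rw [← Finset.mul_sum, E.sum_evalL h]
  γ_right l a m p q h := by
    refine E.evalL_ext fun y => ?_
    simp only [evalL_γL, map_sum, D.evalL_tmul, mul_assoc, D.tL_op, ← D.u_mul_conv]
    rw [← Finset.mul_sum, E.sum_evalL h]
  π_left l a := D.s_injective (by
    rw [map_mul D.s, D.s_π, D.s_π, mul_assoc, D.s_mul_conv])
  -- The element `l` travels all the way round: next to `i` it becomes `u (ν l)`, crosses to the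
  -- second factor, passes the identity there, and returns as `u (μ l)`.
  π_right l a := D.s_injective (by
    rw [map_mul D.s, D.s_π, D.s_π, D.conv_mul_s, mul_assoc a, ← D.i_mul_u_ν, ← mul_assoc a,
      ← D.conv_mul_s', D.tL_op, mul_assoc, ← D.conv_s_mul, one_mul, mul_one])
  coassoc a m p q h := coassoc_of_casimir D.conv D.conv_assoc D.conv_actAL
    D.actLA_conv E.γL E.γL E.γL_apply' E.γL_apply a h h
  counit_left a m p q h := by
    simpa [D.mul_i_conv, D.i_conv] using E.sum_evalL h D.i 1
  counit_right a m p q h := by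
    simpa [D.conv_mul_i, D.conv_i] using E.sum_evalL h 1 D.i
  γ_cross l a m p q h := by
    refine E.evalL_ext fun y => ?_
    simp only [map_sum, D.evalL_tmul, mul_assoc, E.sum_evalL h, D.conv_s_mul, D.tL_op]
  γ_one := by
    refine E.evalL_ext fun y => ?_
    simp only [evalL_γL, D.evalL_tmul, one_mul]
  γ_mul a b m p q m' p' q' h h' := by
    refine E.evalL_ext fun y => ?_
    simp only [evalL_γL, map_sum, D.evalL_tmul, mul_assoc]
    -- The sum over the legs of `a` must be evaluated first, with the legs of `b` as part of the
    -- arguments.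
    rw [Finset.sum_comm]
    simp only [E.sum_evalL h]
    rw [← Finset.mul_sum, E.sum_evalL h']
  π_one := D.s_injective (by rw [D.s_π, one_mul, D.i_conv, map_one])
  π_mul_s a b := D.s_injective (by
    rw [D.s_π (a * _), D.s_π (a * b), mul_assoc, D.s_π_mul_i, mul_assoc])
  π_mul_t a b := D.s_injective (by
    rw [D.s_π, D.s_π, mul_assoc, D.tL_op, D.u_μ_mul_i, D.s_π_mul_i, mul_assoc])

/-- The right bialgebroid of a double algebra. -/
def rightBialgebroid : RightBialgebroid A R where
  s := D.u
  t := D.tR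
  γ := E.γR
  π := D.πR
  comm r r' := (D.s_u_comm _ _).symm
  γ_left r a m p q h := by
    refine E.evalR_ext fun y => ?_
    simp only [evalR_γR, map_sum, D.evalR_tmul, ← mul_assoc, D.tR_apply, ← D.conv_mul_s]
    rw [← Finset.sum_mul, E.sum_evalR h]
  γ_right r a m p q h := by
    refine E.evalR_ext fun y => ?_
    simp only [evalR_γR, map_sum, D.evalR_tmul, ← mul_assoc, ← D.conv_mul_u]
    rw [← Finset.sum_mul, E.sum_evalR h]
  π_left r a := D.u_injective (by
    -- Writing `r` through `μ`, and not `ν`, is what lets `u r` turn into `s l` to the left of `i`.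
    obtain ⟨l, hl⟩ := D.μ.surjective (op r)
    have h : D.u r = D.u (unop (D.μ l)) := by rw [hl, unop_op]
    rw [map_mul D.u, D.u_πR, D.u_πR, ← mul_assoc, D.conv_mul_tR, one_mul, D.u_mul_conv, h,
      ← mul_assoc, D.u_μ_mul_i, mul_assoc, D.conv_s_mul, mul_one])
  π_right r a := D.u_injective (by
    rw [map_mul D.u, D.u_πR, D.u_πR, ← mul_assoc, D.conv_mul_u])
  coassoc a m p q h := coassoc_of_casimir D.conv D.conv_assoc D.conv_actAR
    D.actRA_conv E.γR E.γR E.γR_apply' E.γR_apply a h h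
  counit_left a m p q h := by
    simpa [D.i_mul_conv, D.i_conv] using E.sum_evalR h D.i 1
  counit_right a m p q h := by
    simpa [D.conv_i_mul, D.conv_i] using E.sum_evalR h 1 D.i
  γ_cross r a m p q h := by
    refine E.evalR_ext fun y => ?_
    simp only [map_sum, D.evalR_tmul, ← mul_assoc, E.sum_evalR h, D.conv_mul_tR]
  γ_one := by
    refine E.evalR_ext fun y => ?_
    simp only [evalR_γR, D.evalR_tmul, mul_one]
  γ_mul a b m p q m' p' q' h h' := by
    refine E.evalR_ext fun y => ?_
    simp only [evalR_γR, map_sum, D.evalR_tmul, ← mul_assoc]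
    simp only [E.sum_evalR h']
    rw [← Finset.sum_mul, E.sum_evalR h]
  π_one := D.u_injective (by rw [D.u_πR, mul_one, D.conv_i, map_one])
  π_s_mul a b := D.u_injective (by
    rw [D.u_πR (_ * b), D.u_πR (a * b), ← mul_assoc, D.i_mul_u_πR, ← mul_assoc])
  π_t_mul a b := D.u_injective (by
    rw [D.u_πR, D.u_πR, ← mul_assoc, D.tR_apply, ← D.i_mul_u_ν, RingEquiv.apply_symm_apply,
      unop_op, D.i_mul_u_πR, ← mul_assoc])

/-- The map `x ⊗ y ↦ S x * y` is balanced because the antipode takes the left target to the left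
source. So any expression of the coproduct may be replaced by the one in `γL_apply'`. -/
theorem sum_S_mul {a : A} {m : ℕ} {p q : Fin m → A}
    (h : E.γL a = ∑ k, Bal.tmul (p k) (q k)) : ∑ k, D.S (p k) * q k = D.u (D.πR a) := by
  let f : Bal (actAL D.tL) (actLA D.s) →+ A :=
    Bal.lift (AddMonoidHom.mul.comp D.S.toAddMonoidHom) fun l x y => by
      simp [actAL, actLA, D.S_mul, D.tL_op, D.S_u, mul_assoc]
  have hf := congrArg f (h.symm.trans (E.γL_apply' a))
  simp only [map_sum] at hf
  rw [D.u_πR, ← E.antipode_left]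
  exact hf

theorem sum_mul_S {a : A} {m : ℕ} {p q : Fin m → A}
    (h : E.γR a = ∑ k, Bal.tmul (p k) (q k)) : ∑ k, p k * D.S (q k) = D.s (D.π a) := by
  let f : Bal (actAR D.u) (actRA D.tR) →+ A :=
    Bal.lift (AddMonoidHom.mul.compl₂ D.S.toAddMonoidHom) fun r x y => by
      simp [actAR, actRA, D.S_mul, D.tR_apply, D.S_s, mul_assoc]
  have hf := congrArg f (h.symm.trans (E.γR_apply a))
  simp only [map_sum] at hf
  rw [D.s_π, ← E.antipode_right]
  exact hf

/-- The Hopf algebroid of a double algebra. -/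
def hopfAlgebroid : HopfAlgebroid A L R where
  left := E.leftBialgebroid
  right := E.rightBialgebroid
  S := D.S
  base := ⟨(RingEquiv.opOp R).trans D.ν.op.symm⟩
  range_s_left := by
    change D.s.range = (D.s.comp D.ν.symm.toRingHom).range
    ext x
    simp only [RingHom.mem_range]
    exact ⟨fun ⟨l, h⟩ => ⟨D.ν l, by simpa using h⟩, fun ⟨r, h⟩ => ⟨D.ν.symm r, by simpa using h⟩⟩
  range_t_left := by
    change D.tL.range = D.u.range
    ext x
    simp only [RingHom.mem_range]
    exact ⟨fun ⟨l, h⟩ => ⟨unop (D.μ (unop l)), h⟩,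
      fun ⟨r, h⟩ => ⟨op (D.μ.symm (op r)), by simpa [D.tL_op] using h⟩⟩
  coassoc_left_right a m p q m' p' q' h h' := coassoc_of_casimir D.conv D.conv_assoc D.conv_actAR
    D.actLA_conv E.γL E.γR E.γL_apply' E.γR_apply a h h'
  coassoc_right_left a m p q m' p' q' h h' := coassoc_of_casimir D.conv D.conv_assoc D.conv_actAL
    D.actRA_conv E.γR E.γL E.γR_apply' E.γL_apply a h h'
  S_left l l' a := by
    change D.S (D.tL (op l) * a * D.tL (op l')) = D.s l' * D.S a * D.s l
    rw [D.S_mul, D.S_mul, D.tL_op, D.tL_op, D.S_u, D.S_u, mul_assoc]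
  S_right r r' a := by
    change D.S (D.tR (op r') * a * D.tR (op r)) = D.u r * D.S a * D.u r'
    rw [D.S_mul, D.S_mul, D.tR_apply, D.tR_apply, D.S_s, D.S_s, RingEquiv.apply_symm_apply,
      RingEquiv.apply_symm_apply, unop_op, unop_op, mul_assoc]
  antipode_left a m p q h := E.sum_S_mul h
  antipode_right a m p q h := E.sum_mul_S h

end DistributiveFamily

/-! ### The double algebra of a two-sided dual -/

namespace TwoSidedDual

open Bicategory PreadditiveBicategory

variable {C : Type u} [Bicategory.{w, v} C] {a b : C} {ι : a ⟶ b} {ῑ : b ⟶ a}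
  (D : TwoSidedDual ι ῑ)

theorem convA_assoc (x y z : End (ι ≫ ῑ)) :
    D.convA (D.convA x y) z = D.convA x (D.convA y z) :=
  actPair_injective (by simp only [actPair_convA, FrobeniusPair.conv_assoc])

theorem convA_iA (x : End (ι ≫ ῑ)) : D.convA x D.iA = x :=
  actPair_injective (by simp only [actPair_convA, actPair_iA, FrobeniusPair.conv_iA])

theorem iA_convA (x : End (ι ≫ ῑ)) : D.convA D.iA x = x :=
  actPair_injective (by simp only [actPair_convA, actPair_iA, FrobeniusPair.iA_conv])

theorem convA_comp_whiskerRight (l : ι ⟶ ι) (x y : ι ≫ ῑ ⟶ ι ≫ ῑ) :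
    D.convA x y ≫ l ▷ ῑ = D.convA (x ≫ l ▷ ῑ) y :=
  actPair_injective (by
    simp only [actPair_comp, actPair_convA, actPair_whiskerRight,
      FrobeniusPair.conv_comp_whiskerRight])

theorem whiskerRight_comp_convA (l : ι ⟶ ι) (x y : ι ≫ ῑ ⟶ ι ≫ ῑ) :
    l ▷ ῑ ≫ D.convA x y = D.convA (l ▷ ῑ ≫ x) y :=
  actPair_injective (by
    simp only [actPair_comp, actPair_convA, actPair_whiskerRight,
      FrobeniusPair.whiskerRight_comp_conv])

theorem convA_comp_whiskerLeft (r : ῑ ⟶ ῑ) (x y : ι ≫ ῑ ⟶ ι ≫ ῑ) :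
    D.convA x y ≫ ι ◁ r = D.convA x (y ≫ ι ◁ r) :=
  actPair_injective (by
    simp only [actPair_comp, actPair_convA, actPair_whiskerLeft,
      FrobeniusPair.conv_comp_whiskerLeft])

theorem whiskerLeft_comp_convA (r : ῑ ⟶ ῑ) (x y : ι ≫ ῑ ⟶ ι ≫ ῑ) :
    ι ◁ r ≫ D.convA x y = D.convA x (ι ◁ r ≫ y) :=
  actPair_injective (by
    simp only [actPair_comp, actPair_convA, actPair_whiskerLeft,
      FrobeniusPair.whiskerLeft_comp_conv])

theorem convA_comp_whiskerRight_right (l : ι ⟶ ι) (x y : ι ≫ ῑ ⟶ ι ≫ ῑ) :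
    D.convA x (y ≫ l ▷ ῑ) = D.convA (x ≫ ι ◁ D.mu l) y :=
  actPair_injective (by
    simp only [actPair_comp, actPair_convA, actPair_whiskerLeft, actPair_whiskerRight,
      act_mu, FrobeniusPair.conv_comp_whiskerRight_right])

theorem convA_whiskerRight_comp_right (l : ι ⟶ ι) (x y : ι ≫ ῑ ⟶ ι ≫ ῑ) :
    D.convA x (l ▷ ῑ ≫ y) = D.convA (ι ◁ D.nu l ≫ x) y :=
  actPair_injective (by
    simp only [actPair_comp, actPair_convA, actPair_whiskerLeft, actPair_whiskerRight,
      act_nu, FrobeniusPair.conv_whiskerRight_comp])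

theorem mu_mul (l l' : End ι) : D.mu (l * l') = D.mu l' * D.mu l :=
  act_injective (by simp only [End.mul_def, act_comp, act_mu, FrobeniusPair.mu_comp])

theorem mu_swap_nu (l : End ι) : D.swap.mu (D.nu l) = l :=
  act_injective (by simp only [act_mu, act_nu, pair_swap, FrobeniusPair.mu_swap_nu])

theorem nu_mu_swap (r : End ῑ) : D.nu (D.swap.mu r) = r :=
  act_injective (by simp only [act_mu, act_nu, pair_swap, FrobeniusPair.nu_mu_swap])

/-- `nu` is the inverse of `mu` for the swapped dual, which reverses products. -/
theorem nu_mul (l l' : End ι) : D.nu (l * l') = D.nu l' * D.nu l := by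
  have h : D.swap.mu (D.nu l' * D.nu l) = l * l' := by
    rw [mu_mul, mu_swap_nu, mu_swap_nu]
  rw [← h, nu_mu_swap]

theorem convA_one (x : End (ι ≫ ῑ)) : D.convA x 1 = D.phiL x ▷ ῑ :=
  actPair_injective (by
    simp only [End.one_def, actPair_convA, actPair_id, actPair_whiskerRight, act_phiL,
      FrobeniusPair.conv_id])

theorem phiL_iA_comp_whiskerRight (l : ι ⟶ ι) : D.phiL (D.iA ≫ l ▷ ῑ) = l :=
  act_injective (by
    simp only [act_phiL, actPair_comp, actPair_iA, actPair_whiskerRight,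
      FrobeniusPair.phiL_iA])

theorem convA_mul_iA_one_mul_iA (x : End (ι ≫ ῑ)) :
    D.convA (x * D.iA) 1 * D.iA = x * D.iA :=
  actPair_injective (by
    simp only [End.mul_def, End.one_def, actPair_id, actPair_comp, actPair_convA, actPair_iA,
      FrobeniusPair.iA_conv_id])

theorem fourierDot_swap_fourier (x : End (ι ≫ ῑ)) : D.swap.fourierDot (D.fourier x) = x :=
  actPair_injective (by
    simp only [actPair_fourierDot, actPair_fourier, pair_swap,
      FrobeniusPair.fourierDot_swap_fourier])

theorem fourier_fourierDot_swap (z : End (ῑ ≫ ι)) : D.fourier (D.swap.fourierDot z) = z :=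
  actPair_injective (by
    simp only [actPair_fourierDot, actPair_fourier, pair_swap,
      FrobeniusPair.fourier_fourierDot_swap])

theorem fourier_swap_fourierDot (x : End (ι ≫ ῑ)) : D.swap.fourier (D.fourierDot x) = x :=
  D.swap.fourier_fourierDot_swap x

theorem fourierDot_fourier_swap (z : End (ῑ ≫ ι)) : D.fourierDot (D.swap.fourier z) = z :=
  D.swap.fourierDot_swap_fourier z

theorem fourier_convA (x y : End (ι ≫ ῑ)) :
    D.fourier (D.convA x y) = D.fourier x * D.fourier y :=
  actPair_injective (by
    simp only [End.mul_def, actPair_comp, actPair_fourier, actPair_convA,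
      FrobeniusPair.fourier_conv])

theorem fourierDot_convA (x y : End (ι ≫ ῑ)) :
    D.fourierDot (D.convA x y) = D.fourierDot y * D.fourierDot x :=
  actPair_injective (by
    simp only [End.mul_def, actPair_comp, actPair_fourierDot, actPair_convA,
      FrobeniusPair.fourierDot_conv])

/-- No new diagram is needed: the inverse of `fourier` is `fourierDot` of the swapped dual, whose
effect on convolutions is known. -/
theorem fourier_mul (x y : End (ι ≫ ῑ)) :
    D.fourier (x * y) = D.swap.convA (D.fourier y) (D.fourier x) := by
  have h := D.swap.fourierDot_convA (D.fourier y) (D.fourier x)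
  rw [fourierDot_swap_fourier, fourierDot_swap_fourier] at h
  rw [← h, fourier_fourierDot_swap]

theorem fourierDot_mul (x y : End (ι ≫ ῑ)) :
    D.fourierDot (x * y) = D.swap.convA (D.fourierDot x) (D.fourierDot y) := by
  have h := D.swap.fourier_convA (D.fourierDot x) (D.fourierDot y)
  rw [fourier_swap_fourierDot, fourier_swap_fourierDot] at h
  rw [← h, fourierDot_fourier_swap]

theorem fourier_whiskerLeft_mu (l : End ι) :
    D.fourier (ι ◁ D.mu l) = D.fourierDot (l ▷ ῑ) :=
  actPair_injective (by
    simp only [actPair_fourier, actPair_fourierDot, actPair_whiskerLeft, actPair_whiskerRight,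
      act_mu, FrobeniusPair.fourier_whiskerLeft_mu])

theorem fourier_whiskerRight (l : End ι) :
    D.fourier (l ▷ ῑ) = D.fourierDot (ι ◁ D.nu l) :=
  actPair_injective (by
    simp only [actPair_fourier, actPair_fourierDot, actPair_whiskerLeft, actPair_whiskerRight,
      act_nu, FrobeniusPair.fourier_whiskerRight])

theorem fourier_whiskerRight_comp_iA (l : ι ⟶ ι) :
    D.fourier (l ▷ ῑ ≫ D.iA) = D.nu l ▷ ι :=
  actPair_injective (by
    simp only [actPair_comp, actPair_iA, actPair_fourier, actPair_whiskerRight,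
      act_nu, FrobeniusPair.fourier_whiskerRight_comp_iA])

theorem fourierDot_whiskerRight_comp_iA (l : ι ⟶ ι) :
    D.fourierDot (l ▷ ῑ ≫ D.iA) = ῑ ◁ l :=
  actPair_injective (by
    simp only [actPair_comp, actPair_iA, actPair_fourierDot, actPair_whiskerRight,
      actPair_whiskerLeft, FrobeniusPair.fourierDot_whiskerRight_comp_iA])

theorem fourier_iA_mul_convA_one (x : End (ι ≫ ῑ)) :
    D.fourier (D.iA * D.convA x 1) = D.nu (D.phiL x) ▷ ι := by
  rw [convA_one]
  exact D.fourier_whiskerRight_comp_iA _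

theorem fourierDot_iA_mul_convA_one (x : End (ι ≫ ῑ)) :
    D.fourierDot (D.iA * D.convA x 1) = ῑ ◁ D.phiL x := by
  rw [convA_one]
  exact D.fourierDot_whiskerRight_comp_iA _

/-- A bijection that exchanges the two products must exchange their units. -/
theorem fourier_one : D.fourier 1 = D.swap.iA := by
  have h := D.fourier_mul 1 (D.swap.fourierDot D.swap.iA)
  rw [one_mul, fourier_fourierDot_swap, iA_convA] at h
  exact h.symm

theorem fourierDot_one : D.fourierDot 1 = D.swap.iA := by
  have h := D.fourierDot_mul 1 (D.swap.fourier D.swap.iA)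
  rw [one_mul, fourierDot_fourier_swap, convA_iA] at h
  exact h.symm

theorem fourier_iA : D.fourier D.iA = 1 := by
  have h := D.fourier_convA D.iA (D.swap.fourierDot 1)
  rw [iA_convA, fourier_fourierDot_swap, mul_one] at h
  exact h.symm

theorem fourierDot_iA : D.fourierDot D.iA = 1 := by
  have h := D.fourierDot_convA (D.swap.fourier 1) D.iA
  rw [convA_iA, fourierDot_fourier_swap, mul_one] at h
  exact h.symm

/-! ### Additivity, and the double algebra structure. -/

section Additive

variable [PreadditiveBicategory C]

instance (x : C) {c d : C} (f : c ⟶ d) : (postcomp x f).Additive where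
  map_add := add_whiskerRight _ _ _

theorem convA_add_left (x y z : ι ≫ ῑ ⟶ ι ≫ ῑ) :
    D.convA (x + y : ι ≫ ῑ ⟶ ι ≫ ῑ) z = (D.convA x z + D.convA y z : ι ≫ ῑ ⟶ ι ≫ ῑ) := by
  simp only [convA, add_whiskerRight, Preadditive.add_comp, Preadditive.comp_add]

theorem convA_add_right (x y z : ι ≫ ῑ ⟶ ι ≫ ῑ) :
    D.convA x (y + z : ι ≫ ῑ ⟶ ι ≫ ῑ) = (D.convA x y + D.convA x z : ι ≫ ῑ ⟶ ι ≫ ῑ) := by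
  simp only [convA, whiskerLeft_add, Preadditive.add_comp, Preadditive.comp_add]

theorem fourier_add (x y : ι ≫ ῑ ⟶ ι ≫ ῑ) :
    D.fourier (x + y : ι ≫ ῑ ⟶ ι ≫ ῑ) = (D.fourier x + D.fourier y : ῑ ≫ ι ⟶ ῑ ≫ ι) := by
  simp only [fourier, whiskerLeft_add, add_whiskerRight, Preadditive.add_comp, Preadditive.comp_add]

theorem fourierDot_add (x y : ι ≫ ῑ ⟶ ι ≫ ῑ) :
    D.fourierDot (x + y : ι ≫ ῑ ⟶ ι ≫ ῑ) =
      (D.fourierDot x + D.fourierDot y : ῑ ≫ ι ⟶ ῑ ≫ ι) := by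
  simp only [fourierDot, whiskerLeft_add, add_whiskerRight, Preadditive.add_comp,
    Preadditive.comp_add]

theorem mu_add (x y : ι ⟶ ι) : D.mu (x + y : ι ⟶ ι) = (D.mu x + D.mu y : ῑ ⟶ ῑ) := by
  simp only [mu, whiskerLeft_add, add_whiskerRight, Preadditive.add_comp, Preadditive.comp_add]

theorem nu_add (x y : ι ⟶ ι) : D.nu (x + y : ι ⟶ ι) = (D.nu x + D.nu y : ῑ ⟶ ῑ) := by
  simp only [nu, whiskerLeft_add, add_whiskerRight, Preadditive.add_comp, Preadditive.comp_add]

theorem phiL_add (x y : ι ≫ ῑ ⟶ ι ≫ ῑ) :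
    D.phiL (x + y : ι ≫ ῑ ⟶ ι ≫ ῑ) = (D.phiL x + D.phiL y : ι ⟶ ι) := by
  simp only [phiL, add_whiskerRight, Preadditive.add_comp, Preadditive.comp_add]

/-- The Fourier transform as an additive equivalence. -/
def fourierEquiv : End (ι ≫ ῑ) ≃+ End (ῑ ≫ ι) where
  toFun := D.fourier
  invFun := D.swap.fourierDot
  left_inv := D.fourierDot_swap_fourier
  right_inv := D.fourier_fourierDot_swap
  map_add' := D.fourier_add

/-- The dotted Fourier transform as an additive equivalence. -/
def fourierDotEquiv : End (ι ≫ ῑ) ≃+ End (ῑ ≫ ι) where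
  toFun := D.fourierDot
  invFun := D.swap.fourier
  left_inv := D.fourier_swap_fourierDot
  right_inv := D.fourierDot_fourier_swap
  map_add' := D.fourierDot_add

/-- `μ` as a ring isomorphism. -/
def muEquiv : End ι ≃+* (End ῑ)ᵐᵒᵖ where
  toFun l := op (D.mu l)
  invFun r := D.swap.nu (unop r)
  left_inv l := D.swap.nu_mu_swap l
  right_inv r := congrArg op (D.swap.mu_swap_nu (unop r))
  map_mul' l l' := congrArg op (D.mu_mul l l')
  map_add' l m := congrArg op (D.mu_add l m)

/-- `ν` as a ring isomorphism. -/
def nuEquiv : End ι ≃+* (End ῑ)ᵐᵒᵖ where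
  toFun l := op (D.nu l)
  invFun r := D.swap.mu (unop r)
  left_inv l := D.mu_swap_nu l
  right_inv r := congrArg op (D.nu_mu_swap (unop r))
  map_mul' l l' := congrArg op (D.nu_mul l l')
  map_add' l m := congrArg op (D.nu_add l m)

theorem fourier_sum {n : ℕ} (x : Fin n → End (ι ≫ ῑ)) :
    D.fourier (∑ k, x k) = ∑ k, D.fourier (x k) :=
  map_sum D.fourierEquiv x Finset.univ

theorem fourierDot_sum {n : ℕ} (x : Fin n → End (ι ≫ ῑ)) :
    D.fourierDot (∑ k, x k) = ∑ k, D.fourierDot (x k) :=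
  map_sum D.fourierDotEquiv x Finset.univ

/-- The double algebra `End (ι × ῑ)`. -/
def doubleAlgebra : DoubleAlgebra (End (ι ≫ ῑ)) (End ι) (End ῑ) where
  conv := AddMonoidHom.mk' (fun x => AddMonoidHom.mk' (D.convA x) (D.convA_add_right x))
    fun x y => AddMonoidHom.ext fun z => D.convA_add_left x y z
  i := D.iA
  s :=
    { toFun := fun l => l ▷ ῑ
      map_one' := id_whiskerRight ι ῑ
      map_mul' := fun l l' => comp_whiskerRight l' l ῑ
      map_zero' := (postcomp a ῑ).map_zero ι ι
      map_add' := fun l l' => add_whiskerRight l l' ῑ }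
  u :=
    { toFun := fun r => ι ◁ r
      map_one' := whiskerLeft_id ι ῑ
      map_mul' := fun r r' => Bicategory.whiskerLeft_comp ι r' r
      map_zero' := by simpa using whiskerLeft_add ι (0 : ῑ ⟶ ῑ) 0
      map_add' := whiskerLeft_add ι }
  μ := D.muEquiv
  ν := D.nuEquiv
  -- The inverse of `fourierDot` is `fourier` of the swapped dual, so this is a half turn. Each
  -- product meets exactly one reversal on the way.
  S := D.fourierEquiv.trans D.fourierDotEquiv.symm
  π := AddMonoidHom.mk' (fun x => D.phiL (x * D.iA)) fun x y =>
    (congrArg D.phiL (add_mul x y D.iA)).trans (D.phiL_add _ _)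
  conv_assoc := D.convA_assoc
  conv_i := D.convA_iA
  i_conv := D.iA_convA
  s_u_comm l r := whisker_exchange l r
  s_mul_conv := D.convA_comp_whiskerRight
  conv_mul_s := D.whiskerRight_comp_convA
  u_mul_conv := D.convA_comp_whiskerLeft
  conv_mul_u := D.whiskerLeft_comp_convA
  conv_s_mul := D.convA_comp_whiskerRight_right
  conv_mul_s' := D.convA_whiskerRight_comp_right
  s_injective l l' h := by
    rw [← D.phiL_iA_comp_whiskerRight l, ← D.phiL_iA_comp_whiskerRight l']
    exact congrArg (fun z : End (ι ≫ ῑ) => D.phiL (z * D.iA)) h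
  s_π x := (D.convA_one _).symm
  s_π_mul_i x := by
    have h := D.convA_mul_iA_one_mul_iA x
    rw [D.convA_one] at h
    exact h
  S_mul x y := by
    change D.swap.fourier (D.fourier (x * y)) =
      D.swap.fourier (D.fourier y) * D.swap.fourier (D.fourier x)
    rw [fourier_mul, fourier_convA]
  S_conv x y := by
    change D.swap.fourier (D.fourier (D.convA x y)) =
      D.convA (D.swap.fourier (D.fourier y)) (D.swap.fourier (D.fourier x))
    rw [fourier_convA, fourier_mul]
    rfl
  S_u l := by
    change D.swap.fourier (D.fourier (ι ◁ D.mu l)) = l ▷ ῑ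
    rw [fourier_whiskerLeft_mu, fourier_swap_fourierDot]
  S_s l := by
    change D.swap.fourier (D.fourier (l ▷ ῑ)) = ι ◁ D.nu l
    rw [fourier_whiskerRight, fourier_swap_fourierDot]

end Additive

end TwoSidedDual

/-! ### Quasi-bases -/

namespace TwoSidedDual

open Bicategory PreadditiveBicategory

section QuasiBasis

variable {C : Type u} [Bicategory.{w, v} C] {a b : C} {ι : a ⟶ b} {ῑ : b ⟶ a}
  (D : TwoSidedDual ι ῑ)

/-- Under the duality bijections `x` is an arbitrary 2-cell from `(ι × ῑ) × ι` to `ι` and `y` an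
arbitrary one back. A quasi-basis is thus a resolution of the identity through `ι`. -/
theorem basisTerm_eq (x y : ι ≫ ῑ ⟶ ι ≫ ῑ) :
    D.basisTerm x y = D.left.homEquiv₂.symm x ≫ D.right.homEquiv₂ y := by
  simp [basisTerm, Adjunction.homEquiv₂_symm_apply, Adjunction.homEquiv₂_apply, evL, coevR]

variable [PreadditiveBicategory C]

theorem whiskerLeft_sum {c d e : C} (f : c ⟶ d) {g h : d ⟶ e} {n : ℕ} (θ : Fin n → (g ⟶ h)) :
    f ◁ (∑ k, θ k) = ∑ k, f ◁ θ k :=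
  map_sum (AddMonoidHom.mk' (fun θ : g ⟶ h => f ◁ θ) (whiskerLeft_add f)) θ Finset.univ

theorem whiskerPair_sum {x c : C} {f₁ f₂ : a ⟶ b} {g₁ g₂ : b ⟶ c} {n : ℕ}
    (θ : Fin n → (f₁ ≫ g₁ ⟶ f₂ ≫ g₂)) (f : x ⟶ a) :
    whiskerPair (∑ k, θ k) f = ∑ k, whiskerPair (θ k) f := by
  simp only [whiskerPair, whiskerLeft_sum, Preadditive.sum_comp, Preadditive.comp_sum]

theorem isQuasiBasis_iff {n : ℕ} {y x : Fin n → End (ι ≫ ῑ)} :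
    D.IsQuasiBasis y x ↔ ∑ k, D.basisTerm (x k) (y k) = 𝟙 _ := Iff.rfl

theorem sum_bend_comp_cobend_iff {n : ℕ} (y x : Fin n → End (ι ≫ ῑ)) {z : C} (f : z ⟶ a) :
    ∑ k, ((D.pair z).bend (actPair z (x k))).app f ≫ ((D.pair z).cobend (actPair z (y k))).app f =
      𝟙 (((f ≫ ι) ≫ ῑ) ≫ ι) ↔ f ◁ (∑ k, D.basisTerm (x k) (y k)) = 𝟙 _ := by
  simp only [← whiskerLeft_basisTerm]
  rw [whiskerLeft_sum, ← cancel_epi (tripleIso f).hom, ← cancel_mono (tripleIso f).inv]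
  simp only [Preadditive.sum_comp, Preadditive.comp_sum, Category.assoc, Category.id_comp,
    Iso.hom_inv_id]
  exact Iff.rfl

namespace IsQuasiBasis

variable {D} {n : ℕ} {y x : Fin n → End (ι ≫ ῑ)}

theorem sum_bend_comp_cobend (h : D.IsQuasiBasis y x) {z : C} (f : z ⟶ a) :
    ∑ k, ((D.pair z).bend (actPair z (x k))).app f ≫ ((D.pair z).cobend (actPair z (y k))).app f =
      𝟙 (((f ≫ ι) ≫ ῑ) ≫ ι) := by
  rw [sum_bend_comp_cobend_iff, D.isQuasiBasis_iff.1 h, Bicategory.whiskerLeft_id]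

theorem of_sum_bend_comp_cobend
    (h : ∑ k, ((D.pair a).bend (actPair a (x k))).app (𝟙 a) ≫
      ((D.pair a).cobend (actPair a (y k))).app (𝟙 a) = 𝟙 (((𝟙 a ≫ ι) ≫ ῑ) ≫ ι)) :
    D.IsQuasiBasis y x := by
  rw [sum_bend_comp_cobend_iff] at h
  exact D.isQuasiBasis_iff.2
    (whiskerLeft_id_injective (h.trans (Bicategory.whiskerLeft_id (𝟙 a) _).symm))

/-- Quasi-bases turn products of convolutions into convolutions of products. -/
theorem sum_convA_mul_convA (h : D.IsQuasiBasis y x) (a' c w z : End (ι ≫ ῑ)) :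
    ∑ k, D.convA (a' * y k) w * D.convA (x k * c) z = D.convA (a' * c) (w * z) := by
  refine whiskerPair_injective ((whiskerPair_sum _ _).trans ?_)
  have := (D.pair a).sum_conv_comp_conv (h.sum_bend_comp_cobend (𝟙 a)) (actPair a a')
    (actPair a c) (actPair a z) (actPair a w)
  simp only [← actPair_comp, ← actPair_convA] at this
  exact this

/-- A quasi-basis for `ι` gives one for `ῑ`. -/
theorem swap (h : D.IsQuasiBasis y x) :
    D.swap.IsQuasiBasis (fun k => D.fourier (D.swap.fourier (D.fourier (x k))))
      (fun k => D.fourier (y k)) := by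
  refine of_sum_bend_comp_cobend ?_
  have := (D.pair b).sum_swap_bend_comp_cobend
    (fun f : b ⟶ a => h.sum_bend_comp_cobend f) (𝟙 b)
  simp only [← actPair_fourier, ← pair_swap] at this
  exact this

end IsQuasiBasis

end QuasiBasis

/-! ### Quasi-bases as retractions from sums of copies of `ι`. -/

section Depth

variable {C : Type u} [Bicategory.{w, v} C] [AdditiveBicategory C] {a b : C}
  {ι : a ⟶ b} {ῑ : b ⟶ a} (D : TwoSidedDual ι ῑ)

theorem exists_isQuasiBasis (h : IsLeftD2 ι ῑ) :
    ∃ (n : ℕ) (y x : Fin n → End (ι ≫ ῑ)), D.IsQuasiBasis y x := by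
  obtain ⟨n, ⟨r⟩⟩ := h
  -- The `y k` are the mates of the components of the retraction, the `x k` those of the inclusion.
  refine ⟨n, fun k => D.right.homEquiv₂.symm (biproduct.ι (fun _ => ι) k ≫ r.r),
    fun k => D.left.homEquiv₂ (r.i ≫ biproduct.π (fun _ => ι) k), D.isQuasiBasis_iff.2 ?_⟩
  simp only [basisTerm_eq, Equiv.symm_apply_apply, Equiv.apply_symm_apply]
  calc _ = r.i ≫ (∑ k, biproduct.π (fun _ => ι) k ≫ biproduct.ι (fun _ => ι) k) ≫ r.r := by
        simp only [Preadditive.sum_comp, Preadditive.comp_sum, Category.assoc]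
    _ = _ := by rw [biproduct.total, Category.id_comp, r.retract]

theorem IsQuasiBasis.isLeftD2 {D : TwoSidedDual ι ῑ} {n : ℕ} {y x : Fin n → End (ι ≫ ῑ)}
    (h : D.IsQuasiBasis y x) : IsLeftD2 ι ῑ := by
  refine ⟨n, ⟨⟨biproduct.lift fun k => D.left.homEquiv₂.symm (x k),
    biproduct.desc fun k => D.right.homEquiv₂ (y k), ?_⟩⟩⟩
  rw [biproduct.lift_desc]
  exact (Finset.sum_congr rfl fun k _ => (D.basisTerm_eq (x k) (y k)).symm).trans h

end Depth

end TwoSidedDual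

/-! ### The distributive families of a quasi-basis -/

/-- Half of the laws of a distributive family, the other half follows by applying the antipode. -/
def DoubleAlgebra.distributiveFamily {A L R : Type*} [Ring A] [Ring L] [Ring R]
    (D : DoubleAlgebra A L R) {n : ℕ} (y x : Fin n → A)
    (conv_mul : ∀ a z w, D.conv z w * a = ∑ k, D.conv (z * D.conv a (D.S (x k))) (w * y k))
    (conv_mul' : ∀ a z w, D.conv z w * a = ∑ k, D.conv (z * D.S (x k)) (w * D.conv (y k) a))
    (antipode : ∀ a, ∑ k, y k * D.conv (x k) a = D.conv 1 (D.i * a)) :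
    DistributiveFamily D n where
  -- The inverse antipode applied to both right legs, with the legs interchanged, gives the left
  -- ones.
  p k := D.S.symm (y k)
  q := x
  p' k := D.S (x k)
  q' := y
  mul_conv a z w := D.S.injective (by
    simp only [D.S_mul, D.S_conv, map_sum, AddEquiv.apply_symm_apply, ← conv_mul'])
  mul_conv' a z w := D.S.injective (by
    simp only [D.S_mul, D.S_conv, map_sum, AddEquiv.apply_symm_apply, ← conv_mul])
  conv_mul := conv_mul
  conv_mul' := conv_mul'
  antipode_left a := by simpa only [AddEquiv.apply_symm_apply] using antipode a
  antipode_right a := D.S.symm.injective (by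
    simp only [D.S_symm_mul, D.S_symm_conv, map_sum, AddEquiv.symm_apply_apply, antipode,
      D.S_symm_one, D.S_symm_i])

namespace TwoSidedDual.IsQuasiBasis

open Bicategory PreadditiveBicategory

variable {C : Type u} [Bicategory.{w, v} C] [PreadditiveBicategory C] {a b : C} {ι : a ⟶ b}
  {ῑ : b ⟶ a} {D : TwoSidedDual ι ῑ} {n : ℕ} {y x : Fin n → End (ι ≫ ῑ)}

/-- Quasi-bases turn convolutions of products into products of convolutions. -/
theorem sum_convA_mul (h : D.IsQuasiBasis y x) (w z s t : End (ι ≫ ῑ)) :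
    ∑ k, D.convA (w * D.convA s (D.swap.fourier (D.fourier (x k)))) (z * D.convA (y k) t) =
      D.convA w z * D.convA s t := by
  -- The other interchange law for the rotated quasi-basis in `B` pulls back along `fourier`, with
  -- the two products exchanged.
  have key := h.swap.sum_convA_mul_convA (D.fourier s) (D.fourier t) (D.fourier w) (D.fourier z)
  simp only [← fourier_convA, ← fourier_mul, ← fourier_sum] at key
  exact D.fourierEquiv.injective key

/-- The distributive family on `End (ι × ῑ)` given by a quasi-basis. -/
def family (h : D.IsQuasiBasis y x) : DistributiveFamily D.doubleAlgebra n :=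
  D.doubleAlgebra.distributiveFamily y x
    (fun c z w => by
      have key := h.sum_convA_mul z w c D.iA
      simp only [convA_iA] at key
      exact key.symm)
    (fun c z w => by
      have key := h.sum_convA_mul z w D.iA c
      simp only [iA_convA] at key
      exact key.symm)
    (fun c => by
      have key := h.sum_convA_mul_convA 1 1 D.iA c
      simp only [convA_iA, one_mul, mul_one] at key
      exact key)

/-- The distributive family on `End (ῑ × ι)` given by a quasi-basis for `ι`. -/
def dualFamily (h : D.IsQuasiBasis y x) : DistributiveFamily D.swap.doubleAlgebra n where
  p k := D.fourier (x k)
  q k := D.fourier (y k)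
  p' k := D.fourierDot (y k)
  q' k := D.fourierDot (x k)
  -- The left laws pull back along `fourier` and the right ones along `fourierDot`. All four become
  -- `sum_convA_mul_convA` with one outer factor equal to `1`.
  mul_conv c z w := by
    obtain ⟨c, rfl⟩ := D.fourierEquiv.surjective c
    obtain ⟨z, rfl⟩ := D.fourierEquiv.surjective z
    obtain ⟨w, rfl⟩ := D.fourierEquiv.surjective w
    change D.fourier c * D.swap.convA (D.fourier z) (D.fourier w) =
      ∑ k, D.swap.convA (D.swap.convA (D.fourier c) (D.fourier (x k)) * D.fourier z)
        (D.fourier (y k) * D.fourier w)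
    have key := h.sum_convA_mul_convA 1 c w z
    simp only [one_mul] at key
    simp only [← fourier_mul, ← fourier_convA, ← fourier_sum, key]
  mul_conv' c z w := by
    obtain ⟨c, rfl⟩ := D.fourierEquiv.surjective c
    obtain ⟨z, rfl⟩ := D.fourierEquiv.surjective z
    obtain ⟨w, rfl⟩ := D.fourierEquiv.surjective w
    change D.fourier c * D.swap.convA (D.fourier z) (D.fourier w) =
      ∑ k, D.swap.convA (D.fourier (x k) * D.fourier z)
        (D.swap.convA (D.fourier (y k)) (D.fourier c) * D.fourier w)
    have key := h.sum_convA_mul_convA c 1 w z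
    simp only [mul_one] at key
    simp only [← fourier_mul, ← fourier_convA, ← fourier_sum, key]
  conv_mul c z w := by
    obtain ⟨c, rfl⟩ := D.fourierDotEquiv.surjective c
    obtain ⟨z, rfl⟩ := D.fourierDotEquiv.surjective z
    obtain ⟨w, rfl⟩ := D.fourierDotEquiv.surjective w
    change D.swap.convA (D.fourierDot z) (D.fourierDot w) * D.fourierDot c =
      ∑ k, D.swap.convA (D.fourierDot z * D.swap.convA (D.fourierDot c) (D.fourierDot (y k)))
        (D.fourierDot w * D.fourierDot (x k))
    have key := h.sum_convA_mul_convA c 1 z w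
    simp only [mul_one] at key
    simp only [← fourierDot_mul, ← fourierDot_convA, ← fourierDot_sum, key]
  conv_mul' c z w := by
    obtain ⟨c, rfl⟩ := D.fourierDotEquiv.surjective c
    obtain ⟨z, rfl⟩ := D.fourierDotEquiv.surjective z
    obtain ⟨w, rfl⟩ := D.fourierDotEquiv.surjective w
    change D.swap.convA (D.fourierDot z) (D.fourierDot w) * D.fourierDot c =
      ∑ k, D.swap.convA (D.fourierDot z * D.fourierDot (y k))
        (D.fourierDot w * D.swap.convA (D.fourierDot (x k)) (D.fourierDot c))
    have key := h.sum_convA_mul_convA 1 c z w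
    simp only [one_mul] at key
    simp only [← fourierDot_mul, ← fourierDot_convA, ← fourierDot_sum, key]
  antipode_left c := by
    obtain ⟨c, rfl⟩ := D.fourierEquiv.surjective c
    change ∑ k, D.fourier (D.swap.fourier (D.fourier (x k))) *
        D.swap.convA (D.fourier (y k)) (D.fourier c) =
      D.swap.convA 1 (D.swap.iA * D.fourier c)
    have key := h.sum_convA_mul 1 c D.iA D.iA
    simp only [convA_iA, iA_convA, one_mul] at key
    simp only [← fourier_one, ← fourier_mul, ← fourier_convA, ← fourier_sum, key]
    rw [fourier_mul, fourier_iA]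
  antipode_right c := by
    obtain ⟨c, rfl⟩ := D.fourierEquiv.surjective c
    change ∑ k, D.swap.convA (D.fourier c) (D.fourierDot (y k)) *
        D.fourier (D.swap.fourier (D.fourierDot (x k))) =
      D.swap.convA (D.fourier c * D.swap.iA) 1
    -- The antipode of `B` sends `fourierDot (x k)` to `fourier (x k)`. This makes the sum the
    -- Fourier image of a left distributive law in `A`, applied to `iA`.
    have hk (k : Fin n) : D.swap.convA (D.fourier c) (D.fourierDot (y k)) *
        D.fourier (D.swap.fourier (D.fourierDot (x k))) =
        D.fourier (D.convA (D.swap.fourierDot (D.fourierDot (y k)) * c) (x k)) := by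
      rw [fourier_convA, fourier_mul, fourier_fourierDot_swap, fourier_swap_fourierDot]
    have key : D.iA * D.convA c 1 =
        ∑ k, D.convA (D.convA D.iA (D.swap.fourierDot (D.fourierDot (y k))) * c) (x k * 1) :=
      h.family.mul_conv D.iA c 1
    simp only [iA_convA, mul_one] at key
    simp only [hk, ← fourier_sum, ← key]
    rw [fourier_mul, fourier_convA, fourier_one, fourier_iA]

end TwoSidedDual.IsQuasiBasis

namespace TwoSidedDual

open Bicategory PreadditiveBicategory

variable {C : Type u} [Bicategory.{w, v} C] [PreadditiveBicategory C] {a b : C} {ι : a ⟶ b}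
  {ῑ : b ⟶ a} (D : TwoSidedDual ι ῑ)

/-- The source map is injective, so the counit may be compared after applying it, where `s_π`
expresses it through the two products and their units. The Fourier transform carries these back to
`A`. -/
theorem swap_π_fourier (x : End (ι ≫ ῑ)) :
    D.swap.doubleAlgebra.π (D.fourier x) = D.nu (D.phiL x) := by
  refine D.swap.doubleAlgebra.s_injective ((D.swap.doubleAlgebra.s_π _).trans ?_)
  change D.swap.convA (D.fourier x * D.swap.iA) 1 = D.nu (D.phiL x) ▷ ι
  rw [← fourier_iA_mul_convA_one, fourier_mul, fourier_convA, fourier_one, fourier_iA]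

theorem swap_πR_fourierDot (x : End (ι ≫ ῑ)) :
    D.swap.doubleAlgebra.πR (D.fourierDot x) = D.phiL x := by
  refine D.swap.doubleAlgebra.u_injective ((D.swap.doubleAlgebra.u_πR _).trans ?_)
  change D.swap.convA 1 (D.swap.iA * D.fourierDot x) = ῑ ◁ D.phiL x
  rw [← fourierDot_iA_mul_convA_one, fourierDot_mul, fourierDot_convA, fourierDot_one,
    fourierDot_iA]

end TwoSidedDual

theorem mainTheorem1 {C : Type u} [Bicategory.{w, v} C] [AdditiveBicategory C] {a b : C}
    (ι : a ⟶ b) (ῑ : b ⟶ a) (D : TwoSidedDual ι ῑ) (hD2 : IsLeftD2 ι ῑ) :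
    -- the Fourier transforms and `μ`, `ν` are isomorphisms
    ∃ (F Fdot : End (ι ≫ ῑ) ≃+ End (ῑ ≫ ι)) (μ ν : End ι ≃+* (End ῑ)ᵐᵒᵖ),
      (∀ x, F x = D.fourier x) ∧ (∀ x, Fdot x = D.fourierDot x) ∧
      (∀ l, μ l = op (D.mu l)) ∧ (∀ l, ν l = op (D.nu l)) ∧
      -- `ι` is D2, there are quasi-bases, and each of them yields the two Hopf algebroids
      IsD2 ι ῑ ∧
      (∃ (n : ℕ) (y x : Fin n → End (ι ≫ ῑ)), D.IsQuasiBasis y x) ∧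
      ∀ (n : ℕ) (y x : Fin n → End (ι ≫ ῑ)), D.IsQuasiBasis y x →
        (∃ H : HopfAlgebroid (End (ι ≫ ῑ)) (End ι) (End ῑ),
          (∀ l, H.left.s l = l ▷ ῑ) ∧
          (∀ l, H.left.t (op l) = ι ◁ D.mu l) ∧
          (∀ z, H.left.γ z = ∑ i, Bal.tmul (D.convA z (H.S.symm (y i))) (x i)) ∧
          (∀ z, H.left.γ z = ∑ i, Bal.tmul (H.S.symm (y i)) (D.convA (x i) z)) ∧
          (∀ z, H.left.π z = D.phiL (z * D.iA)) ∧
          (∀ r, H.right.s r = ι ◁ r) ∧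
          (∀ r, H.right.t (op r) = ν.symm (op r) ▷ ῑ) ∧
          (∀ z, H.right.γ z = ∑ i, Bal.tmul (D.convA z (H.S (x i))) (y i)) ∧
          (∀ z, H.right.γ z = ∑ i, Bal.tmul (H.S (x i)) (D.convA (y i) z)) ∧
          (∀ z, H.right.π z = D.nu (D.phiL (H.S.symm z * D.iA))) ∧
          (∀ z, H.S z = Fdot.symm (F z))) ∧
        (∃ H : HopfAlgebroid (End (ῑ ≫ ι)) (End ῑ) (End ι),
          (∀ r, H.left.s r = r ▷ ι) ∧
          (∀ r, H.left.t (op r) = ῑ ◁ ν.symm (op r)) ∧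
          (∀ z, H.left.γ z = ∑ i, Bal.tmul (D.convB z (F (x i))) (F (y i))) ∧
          (∀ z, H.left.γ z = ∑ i, Bal.tmul (F (x i)) (D.convB (F (y i)) z)) ∧
          (∀ z, H.left.π z = D.nu (D.phiL (F.symm z))) ∧
          (∀ l, H.right.s l = ῑ ◁ l) ∧
          (∀ l, H.right.t (op l) = D.mu l ▷ ι) ∧
          (∀ z, H.right.γ z = ∑ i, Bal.tmul (D.convB z (Fdot (y i))) (Fdot (x i))) ∧
          (∀ z, H.right.γ z = ∑ i, Bal.tmul (Fdot (y i)) (D.convB (Fdot (x i)) z)) ∧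
          (∀ z, H.right.π z = D.phiL (Fdot.symm z)) ∧
          (∀ z, H.S z = F (Fdot.symm z))) := by

  refine ⟨D.fourierEquiv, D.fourierDotEquiv, D.muEquiv, D.nuEquiv, fun _ => rfl, fun _ => rfl,
    fun _ => rfl, fun _ => rfl, ?_, D.exists_isQuasiBasis hD2, fun n y x h =>
    ⟨⟨h.family.hopfAlgebroid, ?_⟩, ⟨h.dualFamily.hopfAlgebroid, ?_⟩⟩⟩
  -- Right depth 2 is left depth 2 for the swapped dual, which has the rotated quasi-basis.
  · obtain ⟨n, y, x, h⟩ := D.exists_isQuasiBasis hD2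
    exact ⟨hD2, h.swap.isLeftD2⟩
  · exact ⟨fun _ => rfl, fun _ => rfl, h.family.γL_apply, h.family.γL_apply', fun _ => rfl,
      fun _ => rfl, fun _ => rfl, h.family.γR_apply, h.family.γR_apply', fun _ => rfl,
      fun _ => rfl⟩
  · refine ⟨fun _ => rfl, fun _ => rfl, fun z => ?_, fun z => ?_, fun z => ?_, fun _ => rfl,
      fun _ => rfl, fun z => ?_, fun z => ?_, fun z => ?_, fun _ => rfl⟩
    · simp only [← D.convA_swap]
      exact h.dualFamily.γL_apply z
    · simp only [← D.convA_swap]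
      exact h.dualFamily.γL_apply' z
    · obtain ⟨z, rfl⟩ := D.fourierEquiv.surjective z
      rw [AddEquiv.symm_apply_apply]
      exact D.swap_π_fourier z
    · simp only [← D.convA_swap]
      exact h.dualFamily.γR_apply z
    · simp only [← D.convA_swap]
      exact h.dualFamily.γR_apply' z
    · obtain ⟨z, rfl⟩ := D.fourierDotEquiv.surjective z
      rw [AddEquiv.symm_apply_apply]
      exact D.swap_πR_fourierDot z
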